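/- All graphs are finite and simple. A separator of a graph $G$ is a pair $(A,B)$ of subsets of $V(G)$ with $A\cup B=V(G)$ and with no edge between $A\setminus B$ and $B\setminus A$; its order is $|A\cap B|$, and it is balanced if $|A\setminus B|\le\frac23|V(G)|$ and $|B\setminus A|\le\frac23|V(G)|$. $G$ has $(c,\beta)$-balanced separators if every subgraph $H$ of $G$ has a balanced separator of order at most $c|V(H)|^{\beta}$. An $r$-minor of $G$ is a graph obtained from $G$ by contracting pairwise vertex-disjoint subgraphs of radius at most $r$ and removing vertices and edges. A graph $G$ is an $\alpha$-expander if for every $A\subseteq V(G)$ with $|A|\le |V(G)|/2$ at least $\alpha|A|$ vertices of $V(G)\setminus A$ have a neighbour in $A$. There is an absolute constant $N$ such that the following holds for every integer $n_0\ge 0$ for which $n_0\ge N$ or for which there is a $3$-regular $\frac17$-expander on $n$ vertices for every even $n\ge n_0$. Let $c\ge 1$ and $0<\delta\le 1$ be real, let $\varepsilon=\min\left(1,\frac{\delta}{6(1-\delta)}\right)$ (so $\varepsilon=1$ if $\delta=1$), let $m=\left\lceil\frac{1}{2\varepsilon^2}\right\rceil$ and, for every integer $r\ge1$, let $t(r)$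 be the smallest even integer greater than $\max\left(n_0,(42000\,c\,4^m r)^{1/\delta}\right)$, let $b_{c,\delta,\varepsilon}(r)=2\cdot 32^m\,t(r)^4$, and let $$p_{c,\delta}(r)=316\,c\,\bigl(b_{c,\delta,\varepsilon}(r)\,r\bigr)^{1-\delta}.$$ Then, for every integer $r\ge 1$ and every graph $G$ that has $(c,1-\delta)$-balanced separators, every $r$-minor of $G$ has $\left(p_{c,\delta}(r),\,1-\frac56\delta\right)$-balanced separators. Moreover, for fixed $n_0$, $c$ and $\delta$, $p_{c,\delta}(r)=O\bigl(r^{4/\delta}\bigr)$ as $r\to\infty$. -/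

import Mathlib

/-- A pair `(A, B)` of vertex sets is a separator of `G` if it covers all vertices and no edge joins
`A \ B` with `B \ A`. Its order is `(A ∩ B).ncard`. -/
def SimpleGraph.IsSeparator {V : Type*} (G : SimpleGraph V) (A B : Set V) : Prop :=
  A ∪ B = Set.univ ∧ ∀ a ∈ A \ B, ∀ b ∈ B \ A, ¬ G.Adj a b

/-- A separator is balanced if each of its two sides has at most two thirds of all vertices. -/
def SimpleGraph.IsBalancedSeparator {V : Type*} (G : SimpleGraph V) (A B : Set V) : Prop :=
  G.IsSeparator A B ∧
    ((A \ B).ncard : ℝ) ≤ 2 * (Nat.card V : ℝ) / 3 ∧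
    ((B \ A).ncard : ℝ) ≤ 2 * (Nat.card V : ℝ) / 3

/-- `G` has `(c, β)`-balanced separators: every subgraph `H` of `G` (not necessarily induced) has a
balanced separator of order at most `c * |V(H)| ^ β`. -/
def SimpleGraph.HasBalancedSeparators {V : Type*} (G : SimpleGraph V) (c β : ℝ) : Prop :=
  ∀ H : G.Subgraph, ∃ A B : Set H.verts, H.coe.IsBalancedSeparator A B ∧
    ((A ∩ B).ncard : ℝ) ≤ c * (Nat.card H.verts : ℝ) ^ β

/-- `H` is (up to isomorphism) an `r`-minor of `G`: it arises from `G` by contracting pairwise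
vertex-disjoint subgraphs of radius at most `r` and removing vertices and edges. `B w` is the
subgraph contracted to the vertex `w` (a single vertex if nothing is contracted there). The radius
is measured inside `B w`; it is `⊤` for an empty or a disconnected graph. -/
def SimpleGraph.IsShallowMinor {W V : Type*} (r : ℕ) (H : SimpleGraph W) (G : SimpleGraph V) :
    Prop :=
  ∃ B : W → G.Subgraph,
    (∀ w, (B w).coe.radius ≤ (r : ℕ∞)) ∧
    (∀ w w', w ≠ w' → Disjoint (B w).verts (B w').verts) ∧
    (∀ w w', H.Adj w w' → ∃ x ∈ (B w).verts, ∃ y ∈ (B w').verts, G.Adj x y)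

/-- `G` is an `α`-expander: for every set `A` of at most half of the vertices, at least `α * |A|`
vertices outside `A` have a neighbour in `A`. -/
def SimpleGraph.IsVertexExpander {V : Type*} (G : SimpleGraph V) (α : ℝ) : Prop :=
  ∀ A : Set V, (A.ncard : ℝ) ≤ (Nat.card V : ℝ) / 2 →
    α * (A.ncard : ℝ) ≤ ({v : V | v ∉ A ∧ ∃ a ∈ A, G.Adj a v}.ncard : ℝ)

/-- For every even `n ≥ n₀` there is a `3`-regular `1/7`-expander on `n` vertices. -/
def IsCubicExpanderThreshold (n₀ : ℕ) : Prop :=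
  ∀ n : ℕ, n₀ ≤ n → Even n → ∃ G : SimpleGraph (Fin n),
    (∀ v, (G.neighborSet v).ncard = 3) ∧ G.IsVertexExpander (1 / 7)

/-- `ε = min (1, δ / (6 (1 - δ)))`, where the fraction is `+∞` for `δ = 1`. -/
noncomputable def sepEps (δ : ℝ) : ℝ :=
  if δ = 1 then 1 else min 1 (δ / (6 * (1 - δ)))

/-- `m = ⌈1 / (2 ε²)⌉`. -/
noncomputable def sepM (ε : ℝ) : ℕ := ⌈1 / (2 * ε ^ 2)⌉₊

/-- The smallest even integer greater than `max (n₀, (42000 c 4^m r)^(1/δ))`,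
with `m = ⌈1 / (2 ε²)⌉`. -/
noncomputable def sepT (n₀ : ℕ) (c δ ε : ℝ) (r : ℕ) : ℕ :=
  sInf {t : ℕ | Even t ∧
    max (n₀ : ℝ) ((42000 * c * 4 ^ sepM ε * (r : ℝ)) ^ (1 / δ)) < (t : ℝ)}

/-- `b_{c,δ,ε}(r) = 2 · 32^m · t⁴`. -/
noncomputable def sepB (n₀ : ℕ) (c δ ε : ℝ) (r : ℕ) : ℝ :=
  2 * 32 ^ sepM ε * (sepT n₀ c δ ε r : ℝ) ^ 4

/-- `p_{c,δ}(r) = 316 c (b_{c,δ,ε}(r) r)^(1-δ)`, with `ε = min (1, δ / (6 (1 - δ)))`. -/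
noncomputable def sepP (n₀ : ℕ) (c δ : ℝ) (r : ℕ) : ℝ :=
  316 * c * (sepB n₀ c δ (sepEps δ) r * (r : ℝ)) ^ (1 - δ)

/-! A subgraph of an `r`-minor is again an `r`-minor, so it suffices to split the vertex set of an
`r`-minor `H` with `n` vertices. Realise `H` in a subgraph `K` of `G` that consists of tree paths in
the branch sets and one edge per edge of `H`. With `e` ordered pairs of adjacent vertices in `H`,
these trees have at most `n + e r` vertices. If `H` has no balanced split of order `k`, every cut of
`K` of order at most `k` has a big side, containing more than two thirds of the branch sets. Split
`K` repeatedly, always keeping the big part (`exists_iterated_split`). Parts shrink by a factor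
`2/3` until no branch set fits, a contradiction if the orders of all separators used sum to at most
`k`.

If `1 - δ ≥ 1/20`, these orders form a geometric series, which gives order `316 c (n + e r)^(1 -
δ)`. It remains to see that `e ≤ t² n^(1 + ε)` (`IsShallowMinor.dartsIn_le`). Otherwise take a
vertex set `P` of maximal density `e(P) / |P|^(1 + ε)`; then `|P| > t²`. Linearly many random edges
of `H[P]` already exclude balanced splits of order `ε |P| / 100`. But they form an `r`-minor with
few edges, for which the geometric series yields such a split.

If `1 - δ < 1/20`, the trivial bound `e ≤ n²` leaves a spare power of `n`, which pays for
logarithmically many separators of the largest possible order. The number of rounds must not depend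
on `r`. This is achieved by `hasBalancedSplit_of_pathPartition`, because the trees fall into at most
`n + n³` paths. -/

section

open Finset

/-! ### Splits of vertex sets and balanced separators -/

namespace SimpleGraph

variable {V W : Type*}

/-- `S, D₁, D₂` partition `D` and no edge of `K` joins `D₁` to `D₂`. -/
structure IsSplit [DecidableEq V] (K : SimpleGraph V) (D S D₁ D₂ : Finset V) : Prop where
  cover : D₁ ∪ D₂ ∪ S = D
  disj : Disjoint D₁ D₂
  disj_left : Disjoint D₁ S
  disj_right : Disjoint D₂ S
  not_adj : ∀ a ∈ D₁, ∀ b ∈ D₂, ¬ K.Adj a b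

/-- The vertex set of `H` has a split of order at most `k` into parts of at most `2/3` of it. -/
def HasBalancedSplit [Fintype W] [DecidableEq W] (H : SimpleGraph W) (k : ℝ) : Prop :=
  ∃ S A₁ A₂ : Finset W, H.IsSplit univ S A₁ A₂ ∧ (#S : ℝ) ≤ k ∧
    (#A₁ : ℝ) ≤ 2 * (Fintype.card W : ℝ) / 3 ∧ (#A₂ : ℝ) ≤ 2 * (Fintype.card W : ℝ) / 3

/-- Every vertex set `D` has a split of order at most `c * |D| ^ x` with parts of size at most
`2/3 * |D|`. -/
def HasSplits [DecidableEq V] (K : SimpleGraph V) (c x : ℝ) : Prop :=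
  ∀ D : Finset V, ∃ S D₁ D₂ : Finset V, K.IsSplit D S D₁ D₂ ∧ (#S : ℝ) ≤ c * (#D : ℝ) ^ x ∧
    (#D₁ : ℝ) ≤ 2 * (#D : ℝ) / 3 ∧ (#D₂ : ℝ) ≤ 2 * (#D : ℝ) / 3

/-- Separators exist for all subgraphs of `G`, not only induced ones, so `D` may be equipped with
the edges of `K` alone. -/
theorem HasBalancedSeparators.hasSplits [DecidableEq V] {G K : SimpleGraph V} {c x : ℝ}
    (hG : G.HasBalancedSeparators c x) (hK : K ≤ G) : K.HasSplits c x := by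
  classical
  intro D
  let J : G.Subgraph :=
    { verts := (D : Set V)
      Adj := fun a b => a ∈ D ∧ b ∈ D ∧ K.Adj a b
      adj_sub := fun h => hK h.2.2
      edge_vert := fun h => h.1
      symm := ⟨fun a b h => ⟨h.2.1, h.1, h.2.2.symm⟩⟩ }
  obtain ⟨A, B, ⟨⟨hAB, hne⟩, hA, hB⟩, hS⟩ := hG J
  have hcard : (Nat.card J.verts : ℝ) = #D := by
    have : Nat.card J.verts = #D := by
      change Nat.card (D : Set V) = #D
      simp
    rw [this]
  rw [hcard] at hA hB hS
  have key : ∀ (C : Set J.verts), ∀ F : Finset V, (∀ v (hv : v ∈ D), v ∈ F ↔ (⟨v, hv⟩ : J.verts) ∈ C) →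
      F ⊆ D → #F = C.ncard := by
    intro C F h1 h2
    rw [← Set.ncard_image_of_injective C Subtype.val_injective, ← Set.ncard_coe_finset]
    congr 1
    ext v
    simp only [Finset.mem_coe, Set.mem_image, Subtype.exists, exists_and_right, exists_eq_right]
    constructor
    · intro hv
      exact ⟨h2 hv, (h1 v (h2 hv)).1 hv⟩
    · rintro ⟨hv, h⟩
      exact (h1 v hv).2 h
  let F : Set J.verts → Finset V := fun C => D.filter fun v => ∃ hv : v ∈ D, (⟨v, hv⟩ : J.verts) ∈ C
  have hF : ∀ C, ∀ v (hv : v ∈ D), v ∈ F C ↔ (⟨v, hv⟩ : J.verts) ∈ C := by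
    intro C v hv
    simp [F, hv]
  have hFD : ∀ C, F C ⊆ D := fun C => Finset.filter_subset _ _
  refine ⟨F (A ∩ B), F (A \ B), F (B \ A), ⟨?_, ?_, ?_, ?_, ?_⟩, ?_, ?_, ?_⟩
  · ext v
    constructor
    · intro h
      simp only [Finset.mem_union] at h
      rcases h with (h | h) | h <;> exact hFD _ h
    · intro hv
      have : (⟨v, hv⟩ : J.verts) ∈ A ∪ B := by rw [hAB]; trivial
      simp only [Finset.mem_union, hF _ v hv, Set.mem_sdiff, Set.mem_inter_iff]
      simp only [Set.mem_union] at this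
      tauto
  · rw [Finset.disjoint_left]
    intro v h1 h2
    have hv := hFD _ h1
    rw [hF _ v hv] at h1 h2
    exact h1.2 h2.1
  · rw [Finset.disjoint_left]
    intro v h1 h2
    have hv := hFD _ h1
    rw [hF _ v hv] at h1 h2
    exact h1.2 h2.2
  · rw [Finset.disjoint_left]
    intro v h1 h2
    have hv := hFD _ h1
    rw [hF _ v hv] at h1 h2
    exact h1.2 h2.1
  · intro a ha b hb hab
    have hav := hFD _ ha
    have hbv := hFD _ hb
    rw [hF _ _ hav] at ha
    rw [hF _ _ hbv] at hb
    exact hne _ ha _ hb ⟨hav, hbv, hab⟩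
  · rw [key _ _ (hF (A ∩ B)) (hFD _)]; exact hS
  · rw [key _ _ (hF (A \ B)) (hFD _)]; exact hA
  · rw [key _ _ (hF (B \ A)) (hFD _)]; exact hB

theorem HasBalancedSplit.exists_isBalancedSeparator [Fintype W] [DecidableEq W] {H : SimpleGraph W}
    {k : ℝ} (h : H.HasBalancedSplit k) :
    ∃ A B : Set W, H.IsBalancedSeparator A B ∧ ((A ∩ B).ncard : ℝ) ≤ k := by
  obtain ⟨S, A₁, A₂, hs, hS, h1, h2⟩ := h
  have d0 := Finset.disjoint_left.1 hs.disj
  have d1 := Finset.disjoint_left.1 hs.disj_left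
  have d2 := Finset.disjoint_left.1 hs.disj_right
  have e1 : (((A₁ ∪ S : Finset W) : Set W) \ ((A₂ ∪ S : Finset W) : Set W)) = (A₁ : Set W) := by
    ext v
    have := @d0 v; have := @d1 v
    simp only [Finset.coe_union, Set.mem_sdiff, Set.mem_union, Finset.mem_coe]
    tauto
  have e2 : (((A₂ ∪ S : Finset W) : Set W) \ ((A₁ ∪ S : Finset W) : Set W)) = (A₂ : Set W) := by
    ext v
    have := @d0 v; have := @d2 v
    simp only [Finset.coe_union, Set.mem_sdiff, Set.mem_union, Finset.mem_coe]
    tauto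
  have e3 : (((A₁ ∪ S : Finset W) : Set W) ∩ ((A₂ ∪ S : Finset W) : Set W)) = (S : Set W) := by
    ext v
    have := @d0 v
    simp only [Finset.coe_union, Set.mem_inter_iff, Set.mem_union, Finset.mem_coe]
    tauto
  refine ⟨((A₁ ∪ S : Finset W) : Set W), ((A₂ ∪ S : Finset W) : Set W), ⟨⟨?_, ?_⟩, ?_, ?_⟩, ?_⟩
  · ext v
    have : v ∈ A₁ ∪ A₂ ∪ S := by rw [hs.cover]; simp
    simp only [Finset.coe_union, Set.mem_union, Finset.mem_coe, Set.mem_univ, iff_true]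
    simp only [Finset.mem_union] at this
    tauto
  · rw [e1, e2]
    exact fun a ha b hb => hs.not_adj a ha b hb
  · rw [e1, Set.ncard_coe_finset, Nat.card_eq_fintype_card]; exact h1
  · rw [e2, Set.ncard_coe_finset, Nat.card_eq_fintype_card]; exact h2
  · rw [e3, Set.ncard_coe_finset]; exact hS

/-! ### Minor models and iterated splitting -/

/-- A model of `H` as a minor of `K`: disjoint nonempty branch sets inducing connected subgraphs,
with an edge of `K` between any two of them that represent adjacent vertices of `H`. -/
structure MinorModel (K : SimpleGraph V) (H : SimpleGraph W) where
  branch : W → Finset V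
  nonempty : ∀ w, (branch w).Nonempty
  disj : ∀ w w', w ≠ w' → Disjoint (branch w) (branch w')
  conn : ∀ w (E : Set V), (∀ u ∈ branch w, u ∈ E → ∀ v ∈ branch w, K.Adj u v → v ∈ E) →
    (∃ u ∈ branch w, u ∈ E) → ∀ v ∈ branch w, v ∈ E
  adj : ∀ w w', H.Adj w w' → ∃ u ∈ branch w, ∃ v ∈ branch w', K.Adj u v

namespace MinorModel

variable {K : SimpleGraph V} {H : SimpleGraph W}

/-- The vertices of `H` whose branch sets lie in `E`. -/
def inside [Fintype W] [DecidableEq V] (M : MinorModel K H) (E : Finset V) : Finset W :=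
  univ.filter fun w => M.branch w ⊆ E

theorem mem_inside [Fintype W] [DecidableEq V] {M : MinorModel K H} {E : Finset V} {w : W} :
    w ∈ M.inside E ↔ M.branch w ⊆ E := by
  simp [inside]

theorem card_inside_le [Fintype W] [DecidableEq V] (M : MinorModel K H) (E : Finset V) :
    #(M.inside E) ≤ #E := by
  choose f hf using M.nonempty
  refine Finset.card_le_card_of_injOn f (fun w hw => mem_inside.1 hw (hf w)) ?_
  intro w _ w' _ h
  by_contra hne
  exact Finset.disjoint_left.1 (M.disj w w' hne) (hf w) (h ▸ hf w')

/-- If `H` has no balanced split of order `k`, then a vertex set with boundary of size at most `k`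
either contains more than two thirds of the branch sets or misses that many. -/
theorem inside_or_inside_compl [Fintype V] [DecidableEq V] [Fintype W] [DecidableEq W]
    (M : MinorModel K H) {k : ℝ} (hk : ¬ H.HasBalancedSplit k) {S E : Finset V}
    (hE : ∀ v ∈ E, ∀ u, K.Adj v u → u ∈ E ∪ S) (hSE : Disjoint E S) (hS : (#S : ℝ) ≤ k) :
    2 * (Fintype.card W : ℝ) / 3 < #(M.inside E) ∨
      2 * (Fintype.card W : ℝ) / 3 < #(M.inside (E ∪ S)ᶜ) := by
  by_contra hcon
  push Not at hcon
  apply hk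
  -- Branch sets are disjoint, so at most `#S` of them meet `S`. Each of the others is connected and
  -- therefore lies in `E` or outside `E ∪ S`. If both alternatives fail, this is a balanced split
  -- of `H`.
  let T : Finset W := univ.filter fun w => ∃ v ∈ M.branch w, v ∈ S
  have hT : #T ≤ #S := by
    have : ∀ w : W, ∃ v, w ∈ T → v ∈ M.branch w ∧ v ∈ S := by
      intro w
      by_cases hw : w ∈ T
      · obtain ⟨v, hv⟩ := (Finset.mem_filter.1 hw).2
        exact ⟨v, fun _ => hv⟩
      · exact ⟨(M.nonempty w).choose, fun h => absurd h hw⟩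
    choose f hf using this
    refine Finset.card_le_card_of_injOn f (fun w hw => (hf w hw).2) ?_
    intro w hw w' hw' h
    by_contra hne
    exact Finset.disjoint_left.1 (M.disj w w' hne) (hf w hw).1 (h ▸ (hf w' hw').1)
  have hdis : Disjoint E (E ∪ S)ᶜ := by
    rw [Finset.disjoint_left]; intro v h1 h2; simp [h1] at h2
  refine ⟨T, M.inside E, M.inside (E ∪ S)ᶜ, ⟨?_, ?_, ?_, ?_, ?_⟩, ?_, hcon.1, hcon.2⟩
  · ext w
    simp only [Finset.mem_univ, iff_true, Finset.mem_union, mem_inside]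
    by_cases hw : w ∈ T
    · exact Or.inr hw
    · left
      have hw' : ∀ v ∈ M.branch w, v ∉ S := by
        intro v hv hvS
        exact hw (Finset.mem_filter.2 ⟨Finset.mem_univ _, v, hv, hvS⟩)
      by_cases hex : ∃ u ∈ M.branch w, u ∈ E
      · left
        refine M.conn w (E : Set V) ?_ hex
        intro u _ huE v hv huv
        have := hE u huE v huv
        rw [Finset.mem_union] at this
        exact this.resolve_right (hw' v hv)
      · right
        intro v hv
        push Not at hex
        simp [hex v hv, hw' v hv]
  · rw [Finset.disjoint_left]
    intro w h1 h2
    obtain ⟨v, hv⟩ := M.nonempty w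
    exact Finset.disjoint_left.1 hdis (mem_inside.1 h1 hv) (mem_inside.1 h2 hv)
  · rw [Finset.disjoint_left]
    intro w h1 h2
    obtain ⟨v, hv, hvS⟩ := (Finset.mem_filter.1 h2).2
    exact Finset.disjoint_left.1 hSE (mem_inside.1 h1 hv) hvS
  · rw [Finset.disjoint_left]
    intro w h1 h2
    obtain ⟨v, hv, hvS⟩ := (Finset.mem_filter.1 h2).2
    have := mem_inside.1 h1 hv
    simp [hvS] at this
  · intro w h1 w' h2 hadj
    obtain ⟨u, hu, v, hv, huv⟩ := M.adj w w' hadj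
    have h3 := hE u (mem_inside.1 h1 hu) v huv
    have h4 := mem_inside.1 h2 hv
    rw [Finset.mem_compl] at h4
    exact h4 h3
  · exact le_trans (by exact_mod_cast hT) hS

/-- Each of the three sets misses fewer than a third of the branch sets. -/
theorem exists_mem_inside_three [Fintype V] [DecidableEq V] [Fintype W] [DecidableEq W]
    (M : MinorModel K H) {E₁ E₂ E₃ : Finset V}
    (h1 : 2 * (Fintype.card W : ℝ) / 3 < #(M.inside E₁))
    (h2 : 2 * (Fintype.card W : ℝ) / 3 < #(M.inside E₂))
    (h3 : 2 * (Fintype.card W : ℝ) / 3 < #(M.inside E₃)) :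
    ∃ w, M.branch w ⊆ E₁ ∧ M.branch w ⊆ E₂ ∧ M.branch w ⊆ E₃ := by
  by_contra hcon
  push Not at hcon
  have hcov : (univ : Finset W) = (M.inside E₁)ᶜ ∪ (M.inside E₂)ᶜ ∪ (M.inside E₃)ᶜ := by
    ext w
    simp only [Finset.mem_univ, Finset.mem_union, Finset.mem_compl, mem_inside, true_iff]
    have := hcon w
    tauto
  have hc : Fintype.card W ≤ #(M.inside E₁)ᶜ + #(M.inside E₂)ᶜ + #(M.inside E₃)ᶜ := by
    rw [← Finset.card_univ, hcov]
    exact (Finset.card_union_le _ _).trans (by gcongr; exact Finset.card_union_le _ _)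
  have c1 := Finset.card_add_card_compl (M.inside E₁)
  have c2 := Finset.card_add_card_compl (M.inside E₂)
  have c3 := Finset.card_add_card_compl (M.inside E₃)
  have : 2 * Fintype.card W < 3 * #(M.inside E₁) := by
    have : (2 * (Fintype.card W) : ℝ) < 3 * #(M.inside E₁) := by linarith
    exact_mod_cast this
  have : 2 * Fintype.card W < 3 * #(M.inside E₂) := by
    have : (2 * (Fintype.card W) : ℝ) < 3 * #(M.inside E₂) := by linarith
    exact_mod_cast this
  have : 2 * Fintype.card W < 3 * #(M.inside E₃) := by
    have : (2 * (Fintype.card W) : ℝ) < 3 * #(M.inside E₃) := by linarith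
    exact_mod_cast this
  omega

/-- Repeatedly splitting the part that contains most branch sets. -/
theorem exists_iterated_split [Fintype V] [DecidableEq V] [Fintype W] [DecidableEq W]
    (M : MinorModel K H) {k c x : ℝ} (hc : 0 ≤ c) (hx : 0 ≤ x) (hk : ¬ H.HasBalancedSplit k)
    (hK : K.HasSplits c x) {D₀ R S₀ : Finset V} (hRD : R ⊆ D₀) (hRS : Disjoint R S₀)
    (hR : ∀ v ∈ R, ∀ u, K.Adj v u → u ∈ R ∪ S₀)
    (hw : 2 * (Fintype.card W : ℝ) / 3 < #(M.inside R)) (T : ℕ)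
    (hT : #S₀ + ∑ i ∈ range T, c * ((2 / 3 : ℝ) ^ i * #D₀) ^ x ≤ k) :
    ∃ D S : Finset V, D ⊆ D₀ ∧ Disjoint D S ∧
      (∀ v ∈ D, ∀ u ∈ D₀, K.Adj v u → u ∈ D ∪ S) ∧
      (#S : ℝ) ≤ ∑ i ∈ range T, c * ((2 / 3 : ℝ) ^ i * #D₀) ^ x ∧
      (#D : ℝ) ≤ (2 / 3 : ℝ) ^ T * #D₀ ∧
      2 * (Fintype.card W : ℝ) / 3 < #(M.inside (D ∩ R)) := by
  induction T with
  | zero =>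
    refine ⟨D₀, ∅, subset_rfl, by simp, ?_, by simp, by simp, ?_⟩
    · intro v _ u hu _; simp [hu]
    · rwa [Finset.inter_eq_right.2 hRD]
  | succ T ih =>
    rw [Finset.sum_range_succ] at hT ⊢
    have hnn : 0 ≤ c * ((2 / 3 : ℝ) ^ T * #D₀) ^ x := by positivity
    obtain ⟨D, S, hD, hDS, hadj, hS, hDc, hwD⟩ := ih (by linarith)
    obtain ⟨S', D₁, D₂, hs, hS', h1, h2⟩ := hK D
    have hS'' : (#S' : ℝ) ≤ c * ((2 / 3 : ℝ) ^ T * #D₀) ^ x :=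
      hS'.trans (by gcongr)
    have hcard : (#(S ∪ S') : ℝ) ≤ ∑ i ∈ range T, c * ((2 / 3 : ℝ) ^ i * #D₀) ^ x +
        c * ((2 / 3 : ℝ) ^ T * #D₀) ^ x := by
      have : (#(S ∪ S') : ℝ) ≤ #S + #S' := by exact_mod_cast Finset.card_union_le _ _
      linarith
    have hsub1 : D₁ ⊆ D := by rw [← hs.cover]; intro v hv; simp [hv]
    have hsub2 : D₂ ⊆ D := by rw [← hs.cover]; intro v hv; simp [hv]
    -- The boundary of `D'` is controlled only within `D₀`. Intersecting with `R`, whose boundary in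
    -- the whole graph lies in `S₀`, gives a genuine cut of `K`.
    have key : ∀ D' D'' : Finset V, K.IsSplit D S' D' D'' → (#D' : ℝ) ≤ 2 * (#D : ℝ) / 3 →
        ((D' ⊆ D₀ ∧ Disjoint D' (S ∪ S') ∧
          (∀ v ∈ D', ∀ u ∈ D₀, K.Adj v u → u ∈ D' ∪ (S ∪ S')) ∧
          (#D' : ℝ) ≤ (2 / 3 : ℝ) ^ (T + 1) * #D₀)) ∧
        (2 * (Fintype.card W : ℝ) / 3 < #(M.inside (D' ∩ R)) ∨
        2 * (Fintype.card W : ℝ) / 3 < #(M.inside ((D' ∩ R) ∪ (S₀ ∪ (S ∪ S')))ᶜ)) := by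
      intro D' D'' hs hcD
      have hsub : D' ⊆ D := by rw [← hs.cover]; intro v hv; simp [hv]
      have hdj : Disjoint D' (S ∪ S') :=
        Finset.disjoint_union_right.2 ⟨Finset.disjoint_of_subset_left hsub hDS, hs.disj_left⟩
      have hcl : ∀ v ∈ D', ∀ u ∈ D₀, K.Adj v u → u ∈ D' ∪ (S ∪ S') := by
        intro v hv u hu hvu
        have h3 := hadj v (hsub hv) u hu hvu
        rw [← hs.cover] at h3
        have := hs.not_adj v hv u
        simp only [Finset.mem_union] at h3 ⊢
        tauto
      refine ⟨⟨hsub.trans hD, hdj, hcl, ?_⟩, ?_⟩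
      · rw [pow_succ]; linarith
      · refine M.inside_or_inside_compl hk ?_ ?_ ?_
        · intro v hv u hvu
          rw [Finset.mem_inter] at hv
          have h3 := hR v hv.2 u hvu
          rw [Finset.mem_union] at h3
          rcases h3 with h3 | h3
          · have := hcl v hv.1 u (hRD h3) hvu
            simp only [Finset.mem_union, Finset.mem_inter] at this ⊢
            tauto
          · simp [h3]
        · rw [Finset.disjoint_union_right]
          exact ⟨Finset.disjoint_of_subset_left Finset.inter_subset_right hRS,
            Finset.disjoint_of_subset_left Finset.inter_subset_left hdj⟩
        · have : (#(S₀ ∪ (S ∪ S')) : ℝ) ≤ #S₀ + #(S ∪ S') := by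
            exact_mod_cast Finset.card_union_le _ _
          linarith
    obtain ⟨k1, k2⟩ := key D₁ D₂ hs h1
    obtain ⟨k3, k4⟩ := key D₂ D₁ ⟨by rw [← hs.cover, Finset.union_comm D₂], hs.disj.symm,
      hs.disj_right, hs.disj_left, fun a ha b hb h => hs.not_adj b hb a ha h.symm⟩ h2
    rcases k2 with k2 | k2
    · exact ⟨D₁, S ∪ S', k1.1, k1.2.1, k1.2.2.1, hcard, k1.2.2.2, k2⟩
    rcases k4 with k4 | k4
    · exact ⟨D₂, S ∪ S', k3.1, k3.2.1, k3.2.2.1, hcard, k3.2.2.2, k4⟩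
    -- If neither part is big, some branch set inside `D ∩ R` avoids both parts and the separator
    -- `S'`, although these cover `D`.
    exfalso
    obtain ⟨w, w1, w2, w3⟩ := M.exists_mem_inside_three k2 k4 hwD
    obtain ⟨v, hv⟩ := M.nonempty w
    have v1 := w1 hv
    have v2 := w2 hv
    have v3 := w3 hv
    rw [← hs.cover] at v3
    simp only [Finset.mem_union, Finset.mem_inter, Finset.mem_compl] at v1 v2 v3
    tauto

/-- The branch sets taken together. -/
def support [Fintype W] [DecidableEq V] (M : MinorModel K H) : Finset V := univ.biUnion M.branch

theorem branch_subset_support [Fintype W] [DecidableEq V] (M : MinorModel K H) (w : W) :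
    M.branch w ⊆ M.support :=
  Finset.subset_biUnion_of_mem M.branch (Finset.mem_univ w)

theorem inside_support [Fintype W] [DecidableEq V] (M : MinorModel K H) :
    M.inside M.support = univ := by
  ext w; simp [mem_inside, M.branch_subset_support w]

end MinorModel

end SimpleGraph

/-! ### Separator orders summed as a geometric series -/

namespace SimpleGraph

variable {V W : Type*}

namespace MinorModel

variable {K : SimpleGraph V} {H : SimpleGraph W}

theorem hasBalancedSplit_of_isEmpty [Fintype W] [DecidableEq W] [IsEmpty W] (H : SimpleGraph W)
    {k : ℝ} (hk : 0 ≤ k) : H.HasBalancedSplit k :=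
  ⟨∅, ∅, ∅, ⟨Subsingleton.elim _ _, by simp, by simp, by simp, by simp⟩, by simpa, by simp, by simp⟩

theorem exists_pow_mul_lt_one (N : ℝ) : ∃ T : ℕ, (2 / 3 : ℝ) ^ T * N < 1 := by
  obtain ⟨T, hT⟩ := pow_unbounded_of_one_lt N (by norm_num : (1 : ℝ) < 3 / 2)
  refine ⟨T, ?_⟩
  have h1 : (2 / 3 : ℝ) ^ T * (3 / 2) ^ T = 1 := by rw [← mul_pow]; norm_num
  have h2 : (0 : ℝ) < (2 / 3) ^ T := by positivity
  calc (2 / 3 : ℝ) ^ T * N < (2 / 3 : ℝ) ^ T * (3 / 2) ^ T := by gcongr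
    _ = 1 := h1

/-- This rests on `2/3 ≤ (315/316)^20`. A geometric series of ratio `315/316` sums to `316`, the
constant in `sepP`. -/
theorem two_thirds_rpow_le {x : ℝ} (hx : 1 / 20 ≤ x) : (2 / 3 : ℝ) ^ x ≤ 315 / 316 := by
  calc (2 / 3 : ℝ) ^ x ≤ (2 / 3 : ℝ) ^ (1 / 20 : ℝ) :=
        Real.rpow_le_rpow_of_exponent_ge (by norm_num) (by norm_num) hx
    _ ≤ ((315 / 316 : ℝ) ^ (20 : ℝ)) ^ (1 / 20 : ℝ) := by
        apply Real.rpow_le_rpow (by norm_num) _ (by norm_num)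
        have : ((315 / 316 : ℝ) ^ (20 : ℝ)) = (315 / 316 : ℝ) ^ (20 : ℕ) := by
          rw [← Real.rpow_natCast]; norm_num
        rw [this]; norm_num
    _ = 315 / 316 := by
        rw [← Real.rpow_mul (by norm_num)]; norm_num

theorem sum_splits_le {c x N : ℝ} (hc : 0 ≤ c) (hN : 0 ≤ N) (hx : 1 / 20 ≤ x) (T : ℕ) :
    ∑ i ∈ range T, c * ((2 / 3 : ℝ) ^ i * N) ^ x ≤ 316 * c * N ^ x := by
  have h23 := two_thirds_rpow_le hx
  have h0 : (0 : ℝ) ≤ (2 / 3 : ℝ) ^ x := by positivity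
  have e : ∀ i ∈ range T, c * ((2 / 3 : ℝ) ^ i * N) ^ x = c * N ^ x * ((2 / 3 : ℝ) ^ x) ^ i := by
    intro i _
    rw [Real.mul_rpow (by positivity) hN, ← Real.rpow_natCast, ← Real.rpow_natCast,
      ← Real.rpow_mul (by norm_num), ← Real.rpow_mul (by norm_num), mul_comm (i : ℝ) x]
    ring
  rw [Finset.sum_congr rfl e, ← Finset.mul_sum]
  have hg : ∑ i ∈ range T, ((2 / 3 : ℝ) ^ x) ^ i ≤ 316 := by
    have h1 : ∑ i ∈ range T, ((2 / 3 : ℝ) ^ x) ^ i ≤ ∑ i ∈ range T, (315 / 316 : ℝ) ^ i :=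
      Finset.sum_le_sum fun i _ => pow_le_pow_left₀ h0 h23 i
    have h2 := geom_sum_eq (by norm_num : (315 / 316 : ℝ) ≠ 1) T
    have h3 : (0 : ℝ) ≤ (315 / 316 : ℝ) ^ T := by positivity
    rw [h2] at h1
    refine h1.trans ?_
    rw [div_le_iff_of_neg (by norm_num)]
    linarith
  have : 0 ≤ c * N ^ x := by positivity
  nlinarith

/-- If the exponent is bounded away from `0`, the orders of the iterated splits form a geometric
series. -/
theorem hasBalancedSplit_of_hasSplits [Fintype V] [DecidableEq V] [Fintype W] [DecidableEq W]
    (M : MinorModel K H) {c x : ℝ} (hc : 0 ≤ c) (hx : 1 / 20 ≤ x) (hK : K.HasSplits c x)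
    (hsup : ∀ u v, K.Adj u v → v ∈ M.support) :
    H.HasBalancedSplit (316 * c * (#M.support : ℝ) ^ x) := by
  rcases isEmpty_or_nonempty W with hW | hW
  · exact hasBalancedSplit_of_isEmpty H (by positivity)
  by_contra hk
  have hn : (0 : ℝ) < Fintype.card W := by exact_mod_cast Fintype.card_pos
  -- After this many rounds less than one vertex is left, hence no branch set.
  obtain ⟨T, hT⟩ := exists_pow_mul_lt_one (#M.support)
  obtain ⟨D, S, -, -, -, -, hD, hw⟩ := M.exists_iterated_split hc (by linarith) hk hK
    (D₀ := M.support) (R := M.support) (S₀ := ∅) subset_rfl (by simp)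
    (fun v _ u h => by simp [hsup v u h])
    (by rw [inside_support, Finset.card_univ]; linarith) T
    (by simpa using sum_splits_le hc (by positivity) hx T)
  have h1 : #D < 1 := by exact_mod_cast hD.trans_lt hT
  have h2 := M.card_inside_le (D ∩ M.support)
  have h3 : #(D ∩ M.support) ≤ #D := Finset.card_le_card Finset.inter_subset_left
  have h4 : #(M.inside (D ∩ M.support)) = 0 := by omega
  rw [h4] at hw
  push_cast at hw
  linarith

end MinorModel

/-! ### Path partitions -/

/-- A partition of a vertex set into paths of `K` that start in `ends` and have their other vertices
outside `ends`; each of these other vertices has no further edges, except that the last one is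
joined to the vertex `top u` of `ends`. -/
structure PathPartition (K : SimpleGraph V) where
  ends : Finset V
  len : V → ℕ
  pt : V → ℕ → V
  top : V → V
  pt_zero : ∀ u ∈ ends, pt u 0 = u
  top_mem : ∀ u ∈ ends, top u ∈ ends
  inj : ∀ u ∈ ends, ∀ u' ∈ ends, ∀ i ≤ len u, ∀ j ≤ len u', pt u i = pt u' j → u = u' ∧ i = j
  adj_succ : ∀ u ∈ ends, ∀ i < len u, K.Adj (pt u i) (pt u (i + 1))
  adj_top : ∀ u ∈ ends, 0 < len u → K.Adj (pt u (len u)) (top u)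
  eq_of_adj : ∀ u ∈ ends, ∀ i ≤ len u, 1 ≤ i → ∀ b, K.Adj (pt u i) b →
    b = pt u (i - 1) ∨ (i < len u ∧ b = pt u (i + 1)) ∨ b = top u

namespace PathPartition

variable {K : SimpleGraph V}

/-- `v` lies on, or is attached to, one of the paths with at least `L` inner vertices. -/
def OnLong (Q : PathPartition K) (L : ℕ) (v : V) : Prop :=
  ∃ u ∈ Q.ends, L ≤ Q.len u ∧ ((∃ i ≤ Q.len u, v = Q.pt u i) ∨ v = Q.top u)

/-- A vertex that is neither on nor attached to a long path can therefore be adjacent to a long path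
only at an end. -/
theorem onLong_of_adj (Q : PathPartition K) {L : ℕ} {u : V} (hu : u ∈ Q.ends) (hL : L ≤ Q.len u)
    {i : ℕ} (hi : i ≤ Q.len u) (h1 : 1 ≤ i) {v : V} (h : K.Adj (Q.pt u i) v) : Q.OnLong L v := by
  rcases Q.eq_of_adj u hu i hi h1 v h with h | h | h
  · exact ⟨u, hu, hL, Or.inl ⟨i - 1, by omega, h⟩⟩
  · exact ⟨u, hu, hL, Or.inl ⟨i + 1, by omega, h.2⟩⟩
  · exact ⟨u, hu, hL, Or.inr h⟩

theorem OnLong.mem_ends_or {Q : PathPartition K} {L : ℕ} {v : V} (h : Q.OnLong L v) :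
    v ∈ Q.ends ∨ ∃ u ∈ Q.ends, L ≤ Q.len u ∧ ∃ i ≤ Q.len u, 1 ≤ i ∧ v = Q.pt u i := by
  obtain ⟨u, hu, hL, ⟨i, hi, rfl⟩ | rfl⟩ := h
  · rcases Nat.eq_zero_or_pos i with rfl | h0
    · left; rwa [Q.pt_zero u hu]
    · exact Or.inr ⟨u, hu, hL, i, hi, h0, rfl⟩
  · exact Or.inl (Q.top_mem u hu)

theorem OnLong.of_mem_ends {Q : PathPartition K} {L : ℕ} {v : V} (h : Q.OnLong L v)
    (hv : v ∈ Q.ends) : L ≤ Q.len v ∨ ∃ u ∈ Q.ends, L ≤ Q.len u ∧ v = Q.top u := by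
  obtain ⟨u, hu, hL, ⟨i, hi, h⟩ | h⟩ := h
  · left
    have := Q.inj v hv u hu 0 (Nat.zero_le _) i hi (by rw [Q.pt_zero v hv, h])
    rwa [this.1]
  · exact Or.inr ⟨u, hu, hL, h⟩

/-- The vertices on the paths at distance at most `L` from one of the two ends. -/
theorem exists_near_ends [DecidableEq V] (Q : PathPartition K) (L : ℕ) :
    ∃ F : Finset V, (∀ u ∈ Q.ends, ∀ i ≤ Q.len u, i ≤ L ∨ Q.len u < i + L → Q.pt u i ∈ F) ∧
      (∀ v ∈ F, ∃ u ∈ Q.ends, ∃ i ≤ Q.len u, v = Q.pt u i) ∧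
      (∀ u ∈ Q.ends, ∀ i ≤ Q.len u, Q.pt u i ∉ F → L ≤ Q.len u ∧ 1 ≤ i) ∧
      #F ≤ #Q.ends * (2 * (L + 1)) := by
  classical
  -- The `min` and the truncated subtraction keep the index on the path when the path is short.
  let F₁ := ((Q.ends ×ˢ range (L + 1)).image fun p => Q.pt p.1 (min p.2 (Q.len p.1))) ∪
    ((Q.ends ×ˢ range (L + 1)).image fun p => Q.pt p.1 (Q.len p.1 - p.2))
  have hF : ∀ u ∈ Q.ends, ∀ i ≤ Q.len u, i ≤ L ∨ Q.len u < i + L → Q.pt u i ∈ F₁ := by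
    intro u hu i hi h
    rw [Finset.mem_union]
    rcases h with h | h
    · left
      refine Finset.mem_image.2 ⟨(u, i), ?_, ?_⟩
      · simp [hu]; omega
      · simp [min_eq_left hi]
    · right
      refine Finset.mem_image.2 ⟨(u, Q.len u - i), ?_, ?_⟩
      · simp [hu]; omega
      · simp only
        congr 1
        omega
  refine ⟨F₁, hF, ?_, ?_, ?_⟩
  · intro v hv
    rw [Finset.mem_union] at hv
    rcases hv with hv | hv
    · obtain ⟨⟨u, i⟩, hp, rfl⟩ := Finset.mem_image.1 hv
      exact ⟨u, (Finset.mem_product.1 hp).1, _, min_le_right _ _, rfl⟩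
    · obtain ⟨⟨u, i⟩, hp, rfl⟩ := Finset.mem_image.1 hv
      exact ⟨u, (Finset.mem_product.1 hp).1, _, Nat.sub_le _ _, rfl⟩
  · intro u hu i hi hn
    by_contra hcon
    exact hn (hF u hu i hi (by omega))
  · refine (Finset.card_union_le _ _).trans ?_
    have e : #(Q.ends ×ˢ range (L + 1)) = #Q.ends * (L + 1) := by simp
    have h1 := Finset.card_image_le (s := Q.ends ×ˢ range (L + 1))
      (f := fun p => Q.pt p.1 (min p.2 (Q.len p.1)))
    have h2 := Finset.card_image_le (s := Q.ends ×ˢ range (L + 1))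
      (f := fun p => Q.pt p.1 (Q.len p.1 - p.2))
    rw [e] at h1 h2
    linarith

/-- Every end of a path with at least `L` inner vertices can be extended into a subpath with
`L / 2 + 1` vertices, so that these subpaths are disjoint. -/
theorem exists_half_paths (Q : PathPartition K) (L : ℕ) :
    ∃ f : V → ℕ → V, ∀ x ∈ Q.ends, Q.OnLong L x →
      f x 0 = x ∧ (∀ j < L / 2, K.Adj (f x j) (f x (j + 1))) ∧
      (∀ j ≤ L / 2, ∃ u ∈ Q.ends, ∃ i ≤ Q.len u, f x j = Q.pt u i ∧ (i ≤ L ∨ Q.len u < i + L)) ∧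
      (∀ y ∈ Q.ends, Q.OnLong L y → ∀ i ≤ L / 2, ∀ j ≤ L / 2, f x i = f y j → x = y ∧ i = j) := by
  classical
  have hch : ∀ x, ∃ u, x ∈ Q.ends → Q.OnLong L x → ¬ L ≤ Q.len x →
      u ∈ Q.ends ∧ L ≤ Q.len u ∧ x = Q.top u := by
    intro x
    by_cases h : x ∈ Q.ends ∧ Q.OnLong L x ∧ ¬ L ≤ Q.len x
    · obtain ⟨u, hu⟩ := (h.2.1.of_mem_ends h.1).resolve_left h.2.2
      exact ⟨u, fun _ _ _ => hu⟩
    · exact ⟨x, fun h1 h2 h3 => absurd ⟨h1, h2, h3⟩ h⟩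
  choose g hg using hch
  -- An end that starts a long path follows it forwards. Any other one is the `top` of a long path
  -- and follows that path backwards. Neither direction uses more than half of a path, whence
  -- disjointness.
  let f : V → ℕ → V := fun x j => if L ≤ Q.len x then Q.pt x j else
    if j = 0 then x else Q.pt (g x) (Q.len (g x) + 1 - j)
  have hrep : ∀ x ∈ Q.ends, Q.OnLong L x → ∀ j ≤ L / 2,
      ∃ u ∈ Q.ends, ∃ i ≤ Q.len u, f x j = Q.pt u i ∧
        ((u = x ∧ i = j ∧ (L ≤ Q.len x ∨ j = 0)) ∨
          (L ≤ Q.len u ∧ 1 ≤ j ∧ x = Q.top u ∧ i = Q.len u + 1 - j)) := by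
    intro x hx hxL j hj
    by_cases h : L ≤ Q.len x
    · exact ⟨x, hx, j, by omega, by simp [f, h], Or.inl ⟨rfl, rfl, Or.inl h⟩⟩
    · obtain ⟨h1, h2, h3⟩ := hg x hx hxL h
      by_cases hj0 : j = 0
      · exact ⟨x, hx, 0, Nat.zero_le _, by simp [f, h, hj0, Q.pt_zero x hx],
          Or.inl ⟨rfl, hj0.symm, Or.inr hj0⟩⟩
      · exact ⟨g x, h1, Q.len (g x) + 1 - j, by omega, by simp [f, h, hj0],
          Or.inr ⟨h2, by omega, h3, rfl⟩⟩
  refine ⟨f, fun x hx hxL => ⟨?_, ?_, ?_, ?_⟩⟩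
  · by_cases h : L ≤ Q.len x
    · simp [f, h, Q.pt_zero x hx]
    · simp [f, h]
  · intro j hj
    by_cases h : L ≤ Q.len x
    · simpa [f, h] using Q.adj_succ x hx j (by omega)
    · obtain ⟨h1, h2, h3⟩ := hg x hx hxL h
      by_cases hj0 : j = 0
      · subst hj0
        have := (Q.adj_top (g x) h1 (by omega)).symm
        rw [← h3] at this
        simpa [f, h] using this
      · have := (Q.adj_succ (g x) h1 (Q.len (g x) + 1 - (j + 1)) (by omega)).symm
        rw [show Q.len (g x) + 1 - (j + 1) + 1 = Q.len (g x) + 1 - j by omega] at this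
        simpa [f, h, hj0] using this
  · intro j hj
    obtain ⟨u, hu, i, hi, h1, h2⟩ := hrep x hx hxL j hj
    refine ⟨u, hu, i, hi, h1, ?_⟩
    rcases h2 with ⟨-, h2, -⟩ | h2
    · left; omega
    · rcases Nat.eq_zero_or_pos L with h0 | h0 <;> omega
  · intro y hy hyL i hi j hj hij
    obtain ⟨u, hu, a, ha, h1, h2⟩ := hrep x hx hxL i hi
    obtain ⟨u', hu', a', ha', h1', h2'⟩ := hrep y hy hyL j hj
    obtain ⟨rfl, rfl⟩ := Q.inj u hu u' hu' a ha a' ha' (by rw [← h1, ← h1', hij])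
    rcases h2 with ⟨e1, e2, e3⟩ | ⟨e1, e2, e3, e4⟩ <;>
      rcases h2' with ⟨e1', e2', e3'⟩ | ⟨e1', e2', e3', e4'⟩
    · exact ⟨e1.symm.trans e1', by omega⟩
    · exfalso
      subst e1
      omega
    · exfalso
      subst e1'
      omega
    · exact ⟨e3.trans e3'.symm, by omega⟩

end PathPartition

/-! ### Iterated splitting with few paths of arbitrary length -/

namespace MinorModel

variable {K : SimpleGraph V} {H : SimpleGraph W}

/-- The orders of the splits need only be summed over a number of iterations that is logarithmic in
the number of paths in a path partition, irrespective of the lengths of the paths. -/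
theorem hasBalancedSplit_of_pathPartition [Fintype V] [DecidableEq V] [Fintype W] [DecidableEq W]
    (M : MinorModel K H) (Q : PathPartition K) {c x : ℝ} (hc : 0 ≤ c) (hx : 0 ≤ x)
    (hK : K.HasSplits c x) (hsup : ∀ u v, K.Adj u v → v ∈ M.support)
    (hQ : ∀ v, v ∈ M.support ↔ ∃ u ∈ Q.ends, ∃ i ≤ Q.len u, v = Q.pt u i)
    (hz : ∀ w, ∃ z ∈ M.branch w, z ∈ Q.ends) {T : ℕ}
    (hT : 4 * (#Q.ends : ℝ) < (3 / 2 : ℝ) ^ T) :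
    H.HasBalancedSplit (3 * T * (c * (#M.support : ℝ) ^ x)) := by
  classical
  set a : ℝ := c * (#M.support : ℝ) ^ x with ha
  have ha0 : 0 ≤ a := by positivity
  rcases isEmpty_or_nonempty W with hW | hW
  · exact hasBalancedSplit_of_isEmpty H (by positivity)
  by_contra hk
  have hn : (0 : ℝ) < Fintype.card W := by exact_mod_cast Fintype.card_pos
  have hTa : 0 ≤ T * a := by positivity
  -- `Cut L` asks for a cut whose big side avoids all paths with at least `L` inner vertices, at a
  -- cost independent of `L`. It fails for `L = 0`, since every branch set contains an end, and
  -- holds once no path is that long. The proof refutes a switch from false at `L` to true at `L +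
  -- 1`.
  let Cut : ℕ → Prop := fun L => ∃ S D : Finset V, D ⊆ M.support ∧ Disjoint D S ∧
    (∀ v ∈ D, ∀ u, K.Adj v u → u ∈ D ∪ S) ∧ (#S : ℝ) ≤ 2 * (T * a) ∧
    2 * (Fintype.card W : ℝ) / 3 < #(M.inside D) ∧ ∀ v ∈ D, ¬ Q.OnLong L v
  have h0 : ¬ Cut 0 := by
    rintro ⟨S, D, -, -, -, -, hw, hD⟩
    have : 0 < #(M.inside D) := by
      have : (0 : ℝ) < #(M.inside D) := lt_of_le_of_lt (by positivity) hw
      exact_mod_cast this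
    obtain ⟨w, hw⟩ := Finset.card_pos.1 this
    obtain ⟨z, hz1, hz2⟩ := hz w
    exact hD z (mem_inside.1 hw hz1)
      ⟨z, hz2, Nat.zero_le _, Or.inl ⟨0, Nat.zero_le _, (Q.pt_zero z hz2).symm⟩⟩
  have hbig : ∃ L, Cut L := by
    refine ⟨Q.ends.sup Q.len + 1, ∅, M.support, subset_rfl, by simp,
      fun v _ u h => by simp [hsup v u h], by simpa using hTa, ?_, ?_⟩
    · rw [inside_support, Finset.card_univ]; linarith
    · rintro v - ⟨u, hu, hL, -⟩
      have := Finset.le_sup (f := Q.len) hu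
      omega
  obtain ⟨L, hL, hL'⟩ : ∃ L, ¬ Cut L ∧ Cut (L + 1) := by
    by_contra hcon
    push Not at hcon
    obtain ⟨L, hL⟩ := hbig
    have : ∀ L, ¬ Cut L := fun L => Nat.rec h0 (fun n ih => hcon n ih) L
    exact this L hL
  obtain ⟨S₀, R, hRs, hRS, hRadj, hS₀, hRw, hRL⟩ := hL'
  obtain ⟨F, hF1, hF2, hF3, hFc⟩ := Q.exists_near_ends L
  have hFs : F ⊆ M.support := fun v hv => (hQ v).2 (hF2 v hv)
  -- Vertices of `R` lie on paths with at most `L` inner vertices, or else near an end, so splitting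
  -- can start from `F`, whose size is linear in `L`.
  have hRF : R ⊆ F := by
    intro v hv
    obtain ⟨u, hu, i, hi, rfl⟩ := (hQ v).1 (hRs hv)
    by_contra hcon
    obtain ⟨h1, h2⟩ := hF3 u hu i hi hcon
    refine hRL _ hv ⟨u, hu, ?_, Or.inl ⟨i, hi, rfl⟩⟩
    by_contra h3
    exact hcon (hF1 u hu i hi (by omega))
  have hsum : ∑ i ∈ range T, c * ((2 / 3 : ℝ) ^ i * #F) ^ x ≤ T * a := by
    have : ∀ i ∈ range T, c * ((2 / 3 : ℝ) ^ i * #F) ^ x ≤ a := by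
      intro i _
      rw [ha]
      gcongr
      have h1 : (2 / 3 : ℝ) ^ i ≤ 1 := pow_le_one₀ (by norm_num) (by norm_num)
      have h2 : (#F : ℝ) ≤ #M.support := by exact_mod_cast Finset.card_le_card hFs
      have h3 : (0 : ℝ) ≤ #F := by positivity
      nlinarith
    refine (Finset.sum_le_sum this).trans ?_
    simp
  -- The budget `3 T a` is spent as `2 T a` on `S₀` and `T a` on the new separators.
  obtain ⟨D, S, hDF, hDS, hDadj, hSc, hDc, hDw⟩ := M.exists_iterated_split hc hx hk hK hRF hRS hRadj
    hRw T (by linarith)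
  obtain ⟨f, hf⟩ := Q.exists_half_paths L
  let X : Finset V := D.filter fun v => v ∈ Q.ends ∧ Q.OnLong L v
  have hX : ∀ v, v ∈ X ↔ v ∈ D ∧ v ∈ Q.ends ∧ Q.OnLong L v := fun v => Finset.mem_filter
  -- Half paths run inside `F`, where `D` can be left only through `S`. One that starts in `X` and
  -- avoids `S` would lie in `D`, but by the choice of `T` fewer than `(L + 1) / 2` vertices are
  -- left there.
  by_cases hhalf : ∃ v ∈ X, ∀ j ≤ L / 2, f v j ∉ S
  · obtain ⟨v, hv, hvS⟩ := hhalf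
    obtain ⟨hvD, hvU, hvL⟩ := (hX v).1 hv
    obtain ⟨f0, f1, f2, f3⟩ := hf v hvU hvL
    have hin : ∀ j, j ≤ L / 2 → f v j ∈ D := by
      intro j
      induction j with
      | zero => intro _; rwa [f0]
      | succ j ih =>
        intro hj
        obtain ⟨u, hu, i, hi, e, hiL⟩ := f2 (j + 1) hj
        have := hDadj _ (ih (by omega)) (f v (j + 1)) (e ▸ hF1 u hu i hi hiL) (f1 j (by omega))
        exact (Finset.mem_union.1 this).resolve_right (hvS _ hj)
    have hcard : L / 2 + 1 ≤ #D := by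
      have := Finset.card_le_card_of_injOn (s := range (L / 2 + 1)) (t := D) (f v)
        (fun j hj => hin j (by simp at hj; omega))
        (fun i hi j hj h => (f3 v hvU hvL i (by simp at hi; omega) j (by simp at hj; omega) h).2)
      simpa using this
    have h1 : (L + 1 : ℝ) ≤ 2 * #D := by
      have : L + 1 ≤ 2 * #D := by omega
      exact_mod_cast this
    have h2 : (#F : ℝ) ≤ #Q.ends * (2 * (L + 1)) := by exact_mod_cast hFc
    have h3 : (2 / 3 : ℝ) ^ T * (3 / 2) ^ T = 1 := by rw [← mul_pow]; norm_num
    have h4 : (0 : ℝ) < (2 / 3) ^ T := by positivity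
    have h5 : (2 / 3 : ℝ) ^ T * (4 * #Q.ends) < 1 := by rw [← h3]; gcongr
    have h6 : (2 / 3 : ℝ) ^ T * #F ≤ (2 / 3 : ℝ) ^ T * (#Q.ends * (2 * (L + 1))) := by gcongr
    have h7 : (0 : ℝ) < L + 1 := by positivity
    nlinarith
  · push Not at hhalf
    -- All half paths from `X` meet `S` and they are disjoint. Adding `X` to the separator thus at
    -- most doubles its order, which explains `2 T a` in `Cut`.
    have hXS : #X ≤ #S := by
      have : ∀ v, ∃ j, v ∈ X → j ≤ L / 2 ∧ f v j ∈ S := by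
        intro v
        by_cases hv : v ∈ X
        · obtain ⟨j, hj⟩ := hhalf v hv; exact ⟨j, fun _ => hj⟩
        · exact ⟨0, fun h => absurd h hv⟩
      choose j hj using this
      refine Finset.card_le_card_of_injOn (fun v => f v (j v)) (fun v hv => (hj v hv).2) ?_
      intro v hv v' hv' h
      obtain ⟨-, hv1, hv2⟩ := (hX v).1 hv
      obtain ⟨-, hv1', hv2'⟩ := (hX v').1 hv'
      exact ((hf v hv1 hv2).2.2.2 v' hv1' hv2' _ (hj v hv).1 _ (hj v' hv').1 h).1
    apply hL
    let D' : Finset V := D.filter fun v => ¬ Q.OnLong L v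
    have hD' : ∀ v, v ∈ D' ↔ v ∈ D ∧ ¬ Q.OnLong L v := fun v => Finset.mem_filter
    have hcS : (#(S ∪ X) : ℝ) ≤ 2 * (T * a) := by
      have : (#(S ∪ X) : ℝ) ≤ #S + #X := by exact_mod_cast Finset.card_union_le _ _
      have : (#X : ℝ) ≤ #S := by exact_mod_cast hXS
      linarith
    have hdisj : Disjoint D' (S ∪ X) := by
      rw [Finset.disjoint_union_right]
      constructor
      · exact Finset.disjoint_of_subset_left (Finset.filter_subset _ _) hDS
      · rw [Finset.disjoint_left]
        intro v h1 h2
        exact ((hD' v).1 h1).2 ((hX v).1 h2).2.2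
    have hadj : ∀ v ∈ D', ∀ u, K.Adj v u → u ∈ D' ∪ (S ∪ X) := by
      intro v hv u hvu
      obtain ⟨hvD, hvL⟩ := (hD' v).1 hv
      by_cases huF : u ∈ F
      · have h1 := hDadj v hvD u huF hvu
        by_cases huL : Q.OnLong L u
        · rcases huL.mem_ends_or with h2 | ⟨u', hu', hL', i, hi, hi1, rfl⟩
          · simp only [Finset.mem_union, hX u, hD' u] at h1 ⊢
            tauto
          · exact absurd (Q.onLong_of_adj hu' hL' hi hi1 hvu.symm) hvL
        · simp only [Finset.mem_union, hX u, hD' u] at h1 ⊢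
          tauto
      · obtain ⟨u', hu', i, hi, rfl⟩ := (hQ u).1 (hsup v u hvu)
        obtain ⟨hL', hi1⟩ := hF3 u' hu' i hi huF
        exact absurd (Q.onLong_of_adj hu' hL' hi hi1 hvu.symm) hvL
    refine ⟨S ∪ X, D', (Finset.filter_subset _ _).trans (hDF.trans hFs), hdisj, hadj, hcS, ?_,
      fun v hv => ((hD' v).1 hv).2⟩
    -- A branch set in `D ∩ R` contains an end, which lies in `X` or in `D'` according to whether it
    -- is on a long path. So the far side is not big.
    rcases M.inside_or_inside_compl hk hadj hdisj (by linarith) with h | h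
    · exact h
    · exfalso
      obtain ⟨w, w1, w2, -⟩ := M.exists_mem_inside_three hDw h h
      obtain ⟨z, hz1, hz2⟩ := hz w
      have z1 := w1 hz1
      have z2 := w2 hz1
      simp only [Finset.mem_inter, Finset.mem_compl, Finset.mem_union, hX z, hD' z] at z1 z2
      tauto

end MinorModel

end SimpleGraph

/-! ### Breadth-first trees in the branch sets -/

namespace SimpleGraph

variable {V W : Type*}

/-- The root is a centre, and parents are next vertices on shortest paths to it. The root is its own
parent, so that the parent map can be iterated without bound. -/
theorem exists_parent_of_radius_le {G : SimpleGraph V} (J : G.Subgraph) {r : ℕ}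
    (hJ : J.coe.radius ≤ (r : ℕ∞)) :
    ∃ z ∈ J.verts, ∃ (par : V → V) (lev : V → ℕ), ∀ v ∈ J.verts, lev v ≤ r ∧
      (lev v = 0 ↔ v = z) ∧ par v ∈ J.verts ∧ lev (par v) = lev v - 1 ∧
      (lev v ≠ 0 → G.Adj v (par v)) ∧ (lev v = 0 → par v = v) := by
  classical
  have hne : Nonempty J.verts := by
    by_contra h
    rw [not_nonempty_iff] at h
    have : J.coe.radius = ⊤ := by simp [SimpleGraph.radius]
    rw [this] at hJ
    exact absurd hJ (by simp)
  obtain ⟨z, hz⟩ := J.coe.exists_eccent_eq_radius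
  have hd : ∀ v : J.verts, J.coe.Reachable v z ∧ J.coe.dist v z ≤ r := by
    intro v
    have h1 : J.coe.edist z v ≤ r := (SimpleGraph.edist_le_eccent).trans (hz ▸ hJ)
    have h2 : J.coe.edist z v ≠ ⊤ := ne_top_of_le_ne_top (by simp) h1
    have h3 := SimpleGraph.reachable_of_edist_ne_top h2
    refine ⟨h3.symm, ?_⟩
    rw [SimpleGraph.dist_comm]
    rw [← h3.coe_dist_eq_edist] at h1
    exact_mod_cast h1
  have hstep : ∀ v : J.verts, ∃ u : J.verts, J.coe.dist u z = J.coe.dist v z - 1 ∧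
      (J.coe.dist v z ≠ 0 → J.coe.Adj v u) ∧ (J.coe.dist v z = 0 → u = v) := by
    intro v
    obtain ⟨p, hp⟩ := (hd v).1.exists_walk_length_eq_dist
    cases p with
    | nil => exact ⟨z, by simp, by simp, by simp⟩
    | cons h q =>
      rename_i u
      rw [SimpleGraph.Walk.length_cons] at hp
      refine ⟨u, ?_, fun _ => h, fun h0 => by omega⟩
      have h1 := SimpleGraph.dist_le q
      obtain ⟨q', hq'⟩ := (hd u).1.exists_walk_length_eq_dist
      have h2 := SimpleGraph.dist_le (SimpleGraph.Walk.cons h q')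
      rw [SimpleGraph.Walk.length_cons] at h2
      omega
  choose f hf using hstep
  refine ⟨z, z.2, fun v => if h : v ∈ J.verts then f ⟨v, h⟩ else v,
    fun v => if h : v ∈ J.verts then J.coe.dist ⟨v, h⟩ z else 0, ?_⟩
  intro v hv
  obtain ⟨h1, h2, h3⟩ := hf ⟨v, hv⟩
  simp only [hv, dite_true]
  refine ⟨(hd _).2, ?_, (f ⟨v, hv⟩).2, by simpa using h1, fun h => J.coe_adj_sub _ _ (h2 h), fun h => ?_⟩
  · rw [(hd ⟨v, hv⟩).1.dist_eq_zero_iff, Subtype.ext_iff]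
  · rw [h3 h]

/-- A shallow minor model with a breadth-first search tree in every branch set and with a chosen
edge `port w w' — port w' w` of `G` for every edge `w w'` of `H`. -/
structure RootedModel (H : SimpleGraph W) (G : SimpleGraph V) (r : ℕ) where
  B : W → Set V
  disj : ∀ w w', w ≠ w' → Disjoint (B w) (B w')
  root : W → V
  root_mem : ∀ w, root w ∈ B w
  par : V → V
  lev : V → ℕ
  lev_le : ∀ w, ∀ v ∈ B w, lev v ≤ r
  lev_eq_zero : ∀ w, ∀ v ∈ B w, lev v = 0 ↔ v = root w
  par_mem : ∀ w, ∀ v ∈ B w, par v ∈ B w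
  lev_par : ∀ w, ∀ v ∈ B w, lev (par v) = lev v - 1
  adj_par : ∀ w, ∀ v ∈ B w, lev v ≠ 0 → G.Adj v (par v)
  par_of_lev : ∀ w, ∀ v ∈ B w, lev v = 0 → par v = v
  port : W → W → V
  port_mem : ∀ w w', H.Adj w w' → port w w' ∈ B w
  adj_port : ∀ w w', H.Adj w w' → G.Adj (port w w') (port w' w)

theorem IsShallowMinor.nonempty_rootedModel {H : SimpleGraph W} {G : SimpleGraph V} {r : ℕ}
    (h : H.IsShallowMinor r G) : Nonempty (RootedModel H G r) := by
  classical
  obtain ⟨B, hr, hd, ha⟩ := h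
  choose z hz par lev hp using fun w => exists_parent_of_radius_le (B w) (hr w)
  have hpair : ∀ w w', ∃ a b, H.Adj w w' → a ∈ (B w).verts ∧ b ∈ (B w').verts ∧ G.Adj a b := by
    intro w w'
    by_cases hw : H.Adj w w'
    · obtain ⟨a, h1, b, h2, h3⟩ := ha w w' hw
      exact ⟨a, b, fun _ => ⟨h1, h2, h3⟩⟩
    · exact ⟨z w, z w, fun h => absurd h hw⟩
  choose a b hab using hpair
  -- The well-order selects one orientation of each edge of `H`, so that `port w w'` and `port w' w`
  -- belong to the same edge of `G`.
  let port : W → W → V := fun w w' => if WellOrderingRel w w' then a w w' else b w' w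
  -- Branch sets are disjoint, so parents and levels glue to functions on `V`.
  have hidx : ∀ v, ∃ g : V × ℕ, ∀ w, v ∈ (B w).verts → g = (par w v, lev w v) := by
    intro v
    by_cases hv : ∃ w, v ∈ (B w).verts
    · obtain ⟨w, hw⟩ := hv
      refine ⟨(par w v, lev w v), fun w' hw' => ?_⟩
      by_cases e : w = w'
      · rw [e]
      · exact absurd hw' (Set.disjoint_left.1 (hd w w' e) hw)
    · push Not at hv
      exact ⟨(v, 0), fun w hw => absurd hw (hv w)⟩
  choose g hg using hidx
  have hg1 : ∀ w, ∀ v ∈ (B w).verts, (g v).1 = par w v := fun w v hv => by rw [hg v w hv]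
  have hg2 : ∀ w, ∀ v ∈ (B w).verts, (g v).2 = lev w v := fun w v hv => by rw [hg v w hv]
  refine ⟨{ B := fun w => (B w).verts, disj := hd, root := z, root_mem := hz,
            par := fun v => (g v).1, lev := fun v => (g v).2, port := port,
            lev_le := ?_, lev_eq_zero := ?_, par_mem := ?_, lev_par := ?_, adj_par := ?_,
            par_of_lev := ?_, port_mem := ?_, adj_port := ?_ }⟩
  · intro w v hv; rw [hg2 w v hv]; exact (hp w v hv).1
  · intro w v hv; rw [hg2 w v hv]; exact (hp w v hv).2.1
  · intro w v hv; rw [hg1 w v hv]; exact (hp w v hv).2.2.1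
  · intro w v hv
    rw [hg1 w v hv, hg2 w v hv, hg2 w _ (hp w v hv).2.2.1]; exact (hp w v hv).2.2.2.1
  · intro w v hv; rw [hg1 w v hv, hg2 w v hv]; exact (hp w v hv).2.2.2.2.1
  · intro w v hv; rw [hg1 w v hv, hg2 w v hv]; exact (hp w v hv).2.2.2.2.2
  · intro w w' hw
    by_cases hlt : WellOrderingRel w w'
    · simpa [port, hlt] using (hab w w' hw).1
    · simpa [port, hlt] using (hab w' w hw.symm).2.1
  · intro w w' hw
    rcases trichotomous_of WellOrderingRel w w' with h1 | h1 | h1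
    · simpa [port, h1, asymm_of WellOrderingRel h1] using (hab w w' hw).2.2
    · exact absurd h1 hw.ne
    · simpa [port, h1, asymm_of WellOrderingRel h1] using (hab w' w hw.symm).2.2.symm

/-- The number of ordered pairs of adjacent vertices. -/
noncomputable def numDarts [Fintype W] (H : SimpleGraph W) : ℕ := {p : W × W | H.Adj p.1 p.2}.ncard

namespace RootedModel

variable {H : SimpleGraph W} {G : SimpleGraph V} {r : ℕ}

theorem iterate_mem (X : RootedModel H G r) {w : W} {v : V} (hv : v ∈ X.B w) (i : ℕ) :
    X.par^[i] v ∈ X.B w := by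
  induction i with
  | zero => exact hv
  | succ i ih => rw [Function.iterate_succ_apply']; exact X.par_mem w _ ih

theorem lev_iterate (X : RootedModel H G r) {w : W} {v : V} (hv : v ∈ X.B w) (i : ℕ) :
    X.lev (X.par^[i] v) = X.lev v - i := by
  induction i with
  | zero => simp
  | succ i ih =>
    rw [Function.iterate_succ_apply', X.lev_par w _ (X.iterate_mem hv i), ih]; omega

theorem iterate_eq_root (X : RootedModel H G r) {w : W} {v : V} (hv : v ∈ X.B w) {i : ℕ}
    (hi : X.lev v ≤ i) : X.par^[i] v = X.root w := by
  rw [← X.lev_eq_zero w _ (X.iterate_mem hv i), X.lev_iterate hv]; omega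

theorem par_root (X : RootedModel H G r) (w : W) : X.par (X.root w) = X.root w :=
  X.par_of_lev w _ (X.root_mem w) ((X.lev_eq_zero w _ (X.root_mem w)).2 rfl)

theorem eq_root_of_par_eq (X : RootedModel H G r) {w : W} {v : V} (hv : v ∈ X.B w)
    (h : X.par v = v) : v = X.root w := by
  rw [← X.lev_eq_zero w v hv]
  have := X.lev_par w v hv
  rw [h] at this
  omega

/-- Both ancestor chains reach the root. The first common vertex is where the two tree paths join.
-/
theorem exists_meet (X : RootedModel H G r) {w w₁ w₂ : W} (h1 : H.Adj w w₁) (h2 : H.Adj w w₂) :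
    ∃ i, (∃ j, X.par^[i] (X.port w w₁) = X.par^[j] (X.port w w₂)) ∧
      ∀ i' < i, ¬ ∃ j, X.par^[i'] (X.port w w₁) = X.par^[j] (X.port w w₂) := by
  classical
  have : ∃ i, ∃ j, X.par^[i] (X.port w w₁) = X.par^[j] (X.port w w₂) :=
    ⟨_, _, (X.iterate_eq_root (X.port_mem w w₁ h1) le_rfl).trans
      (X.iterate_eq_root (X.port_mem w w₂ h2) le_rfl).symm⟩
  exact ⟨Nat.find this, Nat.find_spec this, fun i' hi' => Nat.find_min this hi'⟩

variable [Fintype W] [DecidableEq V]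

open Classical in
/-- The union of the tree paths from the ports of `w` to its root. -/
noncomputable def tree (X : RootedModel H G r) (w : W) : Finset V :=
  -- Levels are at most `r`, so iterates from the `r`-th on equal the root.
  insert (X.root w) (((univ.filter (H.Adj w)) ×ˢ range r).image fun p => X.par^[p.2] (X.port w p.1))

theorem mem_tree (X : RootedModel H G r) {w : W} {v : V} :
    v ∈ X.tree w ↔ v = X.root w ∨ ∃ w', H.Adj w w' ∧ ∃ i, v = X.par^[i] (X.port w w') := by
  classical
  simp only [tree, Finset.mem_insert, Finset.mem_image, Finset.mem_product, Finset.mem_filter,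
    Finset.mem_univ, true_and, Finset.mem_range, Prod.exists]
  constructor
  · rintro (h | ⟨w', i, ⟨h1, -⟩, rfl⟩)
    · exact Or.inl h
    · exact Or.inr ⟨w', h1, i, rfl⟩
  · rintro (h | ⟨w', h1, i, rfl⟩)
    · exact Or.inl h
    · by_cases hi : i < r
      · exact Or.inr ⟨w', i, ⟨h1, hi⟩, rfl⟩
      · left
        have := X.port_mem w w' h1
        exact X.iterate_eq_root this ((X.lev_le w _ this).trans (not_lt.1 hi))

theorem tree_subset (X : RootedModel H G r) {w : W} {v : V} (hv : v ∈ X.tree w) : v ∈ X.B w := by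
  rcases X.mem_tree.1 hv with rfl | ⟨w', h, i, rfl⟩
  · exact X.root_mem w
  · exact X.iterate_mem (X.port_mem w w' h) i

theorem root_mem_tree (X : RootedModel H G r) (w : W) : X.root w ∈ X.tree w :=
  X.mem_tree.2 (Or.inl rfl)

theorem port_mem_tree (X : RootedModel H G r) {w w' : W} (h : H.Adj w w') :
    X.port w w' ∈ X.tree w :=
  X.mem_tree.2 (Or.inr ⟨w', h, 0, rfl⟩)

theorem par_mem_tree (X : RootedModel H G r) {w : W} {v : V} (hv : v ∈ X.tree w) :
    X.par v ∈ X.tree w := by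
  rcases X.mem_tree.1 hv with rfl | ⟨w', h, i, rfl⟩
  · rw [X.par_root]; exact X.root_mem_tree w
  · exact X.mem_tree.2 (Or.inr ⟨w', h, i + 1, (Function.iterate_succ_apply' _ _ _).symm⟩)

theorem tree_unique (X : RootedModel H G r) {w w' : W} {v : V} (hv : v ∈ X.tree w)
    (hv' : v ∈ X.tree w') : w = w' := by
  by_contra h
  exact Set.disjoint_left.1 (X.disj w w' h) (X.tree_subset hv) (X.tree_subset hv')

/-- The union of all trees, together with the edges between the ports. -/
def graph (X : RootedModel H G r) : SimpleGraph V where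
  Adj u v := (∃ w, u ∈ X.tree w ∧ v ∈ X.tree w ∧ u ≠ v ∧ (v = X.par u ∨ u = X.par v)) ∨
    ∃ w w', H.Adj w w' ∧ u = X.port w w' ∧ v = X.port w' w
  symm := ⟨by
    rintro u v (⟨w, h1, h2, h3, h4⟩ | ⟨w, w', h1, h2, h3⟩)
    · exact Or.inl ⟨w, h2, h1, h3.symm, h4.symm⟩
    · exact Or.inr ⟨w', w, h1.symm, h3, h2⟩⟩
  loopless := ⟨by
    rintro u (⟨w, h1, h2, h3, h4⟩ | ⟨w, w', h1, h2, h3⟩)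
    · exact h3 rfl
    · exact (X.adj_port w w' h1).ne (h2 ▸ h3)⟩

theorem graph_le (X : RootedModel H G r) : X.graph ≤ G := by
  have key : ∀ w u, u ∈ X.tree w → u ≠ X.par u → G.Adj u (X.par u) := by
    intro w u hu hne
    refine X.adj_par w u (X.tree_subset hu) fun h0 => hne ?_
    exact (X.par_of_lev w u (X.tree_subset hu) h0).symm
  rintro u v (⟨w, h1, h2, h3, rfl | rfl⟩ | ⟨w, w', h1, rfl, rfl⟩)
  · exact key w u h1 h3
  · exact (key w v h2 h3.symm).symm
  · exact X.adj_port w w' h1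

theorem graph_adj_par (X : RootedModel H G r) {w : W} {v : V} (hv : v ∈ X.tree w)
    (h : v ≠ X.par v) : X.graph.Adj v (X.par v) :=
  Or.inl ⟨w, hv, X.par_mem_tree hv, h, Or.inl rfl⟩

/-- The trees are the branch sets of a minor model of `H`. -/
noncomputable def model (X : RootedModel H G r) : MinorModel X.graph H where
  branch := X.tree
  nonempty w := ⟨_, X.root_mem_tree w⟩
  disj w w' h := by
    rw [Finset.disjoint_left]
    intro v hv hv'
    exact h (X.tree_unique hv hv')
  conn := by
    rintro w E hE ⟨u, hu, huE⟩
    -- Membership in `E` is carried up to the root, and from there down to every vertex of the tree.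
    have hroot : ∀ n u, u ∈ X.tree w → u ∈ E → X.lev u = n → X.root w ∈ E := by
      intro n
      induction n with
      | zero =>
        intro u hu huE h0
        rwa [← (X.lev_eq_zero w u (X.tree_subset hu)).1 h0]
      | succ n ih =>
        intro u hu huE hn
        have hl := X.lev_par w u (X.tree_subset hu)
        refine ih (X.par u) (X.par_mem_tree hu) (hE u hu huE _ (X.par_mem_tree hu)
          (X.graph_adj_par hu ?_)) (by omega)
        intro h
        rw [← h] at hl
        omega
    have hr := hroot _ u hu huE rfl
    have hall : ∀ n v, v ∈ X.tree w → X.lev v = n → v ∈ E := by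
      intro n
      induction n with
      | zero =>
        intro v hv h0
        rwa [(X.lev_eq_zero w v (X.tree_subset hv)).1 h0]
      | succ n ih =>
        intro v hv hn
        have hl := X.lev_par w v (X.tree_subset hv)
        refine hE _ (X.par_mem_tree hv) (ih _ (X.par_mem_tree hv) (by omega)) v hv
          (X.graph_adj_par hv ?_).symm
        intro h
        rw [← h] at hl
        omega
    exact fun v hv => hall _ v hv rfl
  adj w w' h := ⟨_, X.port_mem_tree h, _, X.port_mem_tree h.symm, Or.inr ⟨w, w', h, rfl, rfl⟩⟩

theorem mem_support (X : RootedModel H G r) {v : V} : v ∈ X.model.support ↔ ∃ w, v ∈ X.tree w := by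
  simp [MinorModel.support, model]

theorem mem_support_of_adj (X : RootedModel H G r) {u v : V} (h : X.graph.Adj u v) :
    v ∈ X.model.support := by
  rw [X.mem_support]
  rcases h with ⟨w, -, h, -⟩ | ⟨w, w', h, -, rfl⟩
  · exact ⟨w, h⟩
  · exact ⟨w', X.port_mem_tree h.symm⟩

theorem card_support_le (X : RootedModel H G r) :
    #X.model.support ≤ Fintype.card W + H.numDarts * r := by
  classical
  let F : Finset (W × W) := univ.filter fun p => H.Adj p.1 p.2
  have hF : #F = H.numDarts := by
    rw [numDarts, ← Set.ncard_coe_finset]; congr 1; ext p; simp [F]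
  have hsub : X.model.support ⊆ univ.image X.root ∪
      (F ×ˢ range r).image fun p => X.par^[p.2] (X.port p.1.1 p.1.2) := by
    intro v hv
    obtain ⟨w, hw⟩ := X.mem_support.1 hv
    simp only [tree, Finset.mem_insert, Finset.mem_image, Finset.mem_product, Finset.mem_filter,
      Finset.mem_univ, true_and, Finset.mem_range, Prod.exists] at hw
    simp only [Finset.mem_union, Finset.mem_image, Finset.mem_univ, true_and, Finset.mem_product,
      Finset.mem_range, Prod.exists, F, Finset.mem_filter]
    rcases hw with rfl | ⟨w', i, h, rfl⟩
    · exact Or.inl ⟨w, rfl⟩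
    · exact Or.inr ⟨w, w', i, h, rfl⟩
  refine (Finset.card_le_card hsub).trans ((Finset.card_union_le _ _).trans ?_)
  refine add_le_add (by simpa using Finset.card_image_le (s := univ) (f := X.root)) ?_
  refine Finset.card_image_le.trans ?_
  rw [Finset.card_product, hF, Finset.card_range]

/-! ### Cutting the trees into few paths -/

/-- A small set of vertices outside of which every vertex of the trees has exactly one child. -/
theorem exists_branching (X : RootedModel H G r) :
    ∃ U : Finset V, #U ≤ Fintype.card W + Fintype.card W ^ 3 ∧ U ⊆ X.model.support ∧
      (∀ w, X.root w ∈ U) ∧ (∀ w w', H.Adj w w' → X.port w w' ∈ U) ∧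
      ∀ v c c', v ∉ U → c ∈ X.model.support → c' ∈ X.model.support → X.par c = v → X.par c' = v →
        c ≠ v → c' ≠ v → c = c' := by
  classical
  have hm : ∀ p : W × W × W, ∃ i, H.Adj p.1 p.2.1 → H.Adj p.1 p.2.2 →
      (∃ j, X.par^[i] (X.port p.1 p.2.1) = X.par^[j] (X.port p.1 p.2.2)) ∧
      ∀ i' < i, ¬ ∃ j, X.par^[i'] (X.port p.1 p.2.1) = X.par^[j] (X.port p.1 p.2.2) := by
    rintro ⟨w, w₁, w₂⟩
    by_cases h : H.Adj w w₁ ∧ H.Adj w w₂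
    · obtain ⟨i, hi⟩ := X.exists_meet h.1 h.2
      exact ⟨i, fun _ _ => hi⟩
    · exact ⟨0, fun h1 h2 => absurd ⟨h1, h2⟩ h⟩
  choose m hm using hm
  let F : Finset (W × W × W) := univ.filter fun p => H.Adj p.1 p.2.1 ∧ H.Adj p.1 p.2.2
  -- The point where the chain from `port w w₁` joins the chain from `port w w₂`; for `w₁ = w₂` it
  -- is the port itself.
  let g : W × W × W → V := fun p => X.par^[m p] (X.port p.1 p.2.1)
  have hgU : ∀ {w w₁ w₂}, H.Adj w w₁ → H.Adj w w₂ →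
      g (w, w₁, w₂) ∈ univ.image X.root ∪ F.image g := by
    intro w w₁ w₂ h1 h2
    exact Finset.mem_union_right _ (Finset.mem_image_of_mem g (by simp [F, h1, h2]))
  refine ⟨univ.image X.root ∪ F.image g, ?_, ?_, ?_, ?_, ?_⟩
  · refine (Finset.card_union_le _ _).trans (add_le_add ?_ ?_)
    · simpa using Finset.card_image_le (s := univ) (f := X.root)
    · refine Finset.card_image_le.trans ((Finset.card_filter_le _ _).trans ?_)
      simp only [Finset.card_univ, Fintype.card_prod]
      exact le_of_eq (by ring)
  · intro v hv
    rw [X.mem_support]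
    simp only [Finset.mem_union, Finset.mem_image, Finset.mem_univ, true_and] at hv
    rcases hv with ⟨w, rfl⟩ | ⟨p, hp, rfl⟩
    · exact ⟨w, X.root_mem_tree w⟩
    · exact ⟨p.1, X.mem_tree.2 (Or.inr ⟨_, (Finset.mem_filter.1 hp).2.1, _, rfl⟩)⟩
  · intro w; simp
  · intro w w' h
    have := hgU h h
    have h0 : m (w, w', w') = 0 := by
      by_contra h0
      exact (hm (w, w', w') h h).2 0 (Nat.pos_of_ne_zero h0) ⟨0, rfl⟩
    simpa only [g, h0, Function.iterate_zero, id] using this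
  · intro v c c' hv hc hc' hcv hcv' hne hne'
    obtain ⟨w, hw⟩ := X.mem_support.1 hc
    obtain ⟨w', hw'⟩ := X.mem_support.1 hc'
    obtain rfl : w = w' := X.tree_unique (hcv ▸ X.par_mem_tree hw) (hcv' ▸ X.par_mem_tree hw')
    have hl := X.lev_par w c (X.tree_subset hw)
    have hl' := X.lev_par w c' (X.tree_subset hw')
    have h0 : X.lev c ≠ 0 := fun h => hne (hcv ▸ (X.par_of_lev w c (X.tree_subset hw) h).symm)
    have h0' : X.lev c' ≠ 0 := fun h => hne' (hcv' ▸ (X.par_of_lev w c' (X.tree_subset hw') h).symm)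
    rw [hcv] at hl
    rw [hcv'] at hl'
    have hroot : ∀ {c}, X.par c = v → c ≠ v → c ≠ X.root w := by
      rintro c h1 h2 rfl
      exact h2 ((X.par_root w).symm.trans h1)
    obtain ⟨w₁, h1, i, hi⟩ := (X.mem_tree.1 hw).resolve_left (hroot hcv hne)
    obtain ⟨w₂, h2, j, hj⟩ := (X.mem_tree.1 hw').resolve_left (hroot hcv' hne')
    obtain ⟨⟨j₀, hj₀⟩, hmin⟩ := hm (w, w₁, w₂) h1 h2
    have hvi : v = X.par^[i + 1] (X.port w w₁) := by
      rw [Function.iterate_succ_apply', ← hi, hcv]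
    have hvj : v = X.par^[j + 1] (X.port w w₂) := by
      rw [Function.iterate_succ_apply', ← hj, hcv']
    have hle : m (w, w₁, w₂) ≤ i + 1 := by
      by_contra hlt
      exact hmin (i + 1) (not_le.1 hlt) ⟨j + 1, hvi.symm.trans hvj⟩
    -- The chains have met at `v`, but not for the first time, as `v ∉ U`. Hence `c` is already on
    -- the chain of `c'`, and there it is determined by its level.
    have hlt : m (w, w₁, w₂) ≤ i := by
      by_contra hgt
      have e : m (w, w₁, w₂) = i + 1 := by omega
      apply hv
      have := hgU h1 h2
      simp only [g, e] at this
      rwa [hvi]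
    have hc2 : c = X.par^[i - m (w, w₁, w₂) + j₀] (X.port w w₂) := by
      rw [Function.iterate_add_apply, ← hj₀, ← Function.iterate_add_apply, hi]
      congr 1
      omega
    have hp := X.port_mem w w₂ h2
    have l1 := X.lev_iterate hp (i - m (w, w₁, w₂) + j₀)
    have l2 := X.lev_iterate hp j
    rw [← hc2] at l1
    rw [← hj] at l2
    rw [hc2, hj]
    congr 1
    omega

/-- The trees are partitioned into few paths. -/
theorem exists_pathPartition (X : RootedModel H G r) :
    ∃ Q : PathPartition X.graph, #Q.ends ≤ Fintype.card W + Fintype.card W ^ 3 ∧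
      (∀ v, v ∈ X.model.support ↔ ∃ u ∈ Q.ends, ∃ i ≤ Q.len u, v = Q.pt u i) ∧
      ∀ w, ∃ z ∈ X.model.branch w, z ∈ Q.ends := by
  classical
  obtain ⟨U, hUc, hUs, hUr, hUp, hU⟩ := X.exists_branching
  have hpar : ∀ v ∈ X.model.support, X.par v ∈ X.model.support := by
    intro v hv
    obtain ⟨w, hw⟩ := X.mem_support.1 hv
    exact X.mem_support.2 ⟨w, X.par_mem_tree hw⟩
  have hit : ∀ v ∈ X.model.support, ∀ i, X.par^[i] v ∈ X.model.support := by
    intro v hv i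
    induction i with
    | zero => exact hv
    | succ i ih => rw [Function.iterate_succ_apply']; exact hpar _ ih
  have hfix : ∀ v ∈ X.model.support, X.par v = v → v ∈ U := by
    intro v hv h
    obtain ⟨w, hw⟩ := X.mem_support.1 hv
    rw [X.eq_root_of_par_eq (X.tree_subset hw) h]
    exact hUr w
  have hadj : ∀ v ∈ X.model.support, v ∉ U → X.graph.Adj v (X.par v) := by
    intro v hv hvU
    obtain ⟨w, hw⟩ := X.mem_support.1 hv
    exact X.graph_adj_par hw fun h => hvU (hfix v hv h.symm)
  have hex : ∀ u ∈ U, ∃ i, X.par^[i + 1] u ∈ U := by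
    intro u hu
    obtain ⟨w, hw⟩ := X.mem_support.1 (hUs hu)
    refine ⟨X.lev u, ?_⟩
    rw [X.iterate_eq_root (X.tree_subset hw) (Nat.le_succ _)]
    exact hUr w
  -- The path from `u` follows parents and stops just before the next vertex of `U`, which becomes
  -- its `top`.
  let len : V → ℕ := fun u => sInf {i | X.par^[i + 1] u ∈ U}
  have hlen : ∀ u ∈ U, X.par^[len u + 1] u ∈ U := fun u hu => Nat.sInf_mem (hex u hu)
  have hlt : ∀ u, ∀ i, 1 ≤ i → i ≤ len u → X.par^[i] u ∉ U := by
    intro u i h1 h2 h3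
    have : i - 1 ∈ {i | X.par^[i + 1] u ∈ U} := by
      change X.par^[i - 1 + 1] u ∈ U
      rwa [Nat.sub_add_cancel h1]
    have : len u ≤ i - 1 := Nat.sInf_le this
    omega
  have hchild : ∀ u ∈ U, ∀ i, 1 ≤ i → i ≤ len u → X.par (X.par^[i - 1] u) = X.par^[i] u ∧
      X.par^[i - 1] u ≠ X.par^[i] u := by
    intro u hu i h1 h2
    have e : X.par (X.par^[i - 1] u) = X.par^[i] u := by
      rw [← Function.iterate_succ_apply' X.par, Nat.succ_eq_add_one, Nat.sub_add_cancel h1]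
    refine ⟨e, fun h => hlt u i h1 h2 ?_⟩
    rw [← h] at e ⊢
    exact hfix _ (hit u (hUs hu) _) e
  -- Paths cannot merge outside `U`, where children are unique; a common vertex is traced back to a
  -- common start.
  have hinj : ∀ i, ∀ j, ∀ u ∈ U, ∀ u' ∈ U, i ≤ len u → j ≤ len u' →
      X.par^[i] u = X.par^[j] u' → u = u' ∧ i = j := by
    intro i
    induction i with
    | zero =>
      intro j u hu u' hu' _ hj h
      rcases Nat.eq_zero_or_pos j with rfl | h0
      · exact ⟨h, rfl⟩
      · exact absurd (h ▸ hu : X.par^[j] u' ∈ U) (hlt u' j h0 hj)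
    | succ i ih =>
      intro j u hu u' hu' hi hj h
      rcases Nat.eq_zero_or_pos j with rfl | h0
      · exact absurd (h ▸ hu' : X.par^[i + 1] u ∈ U) (hlt u _ (by omega) hi)
      · obtain ⟨a1, a2⟩ := hchild u hu (i + 1) (by omega) hi
        obtain ⟨b1, b2⟩ := hchild u' hu' j h0 hj
        rw [← h] at b1 b2
        have := hU _ _ _ (hlt u _ (by omega) hi) (hit u (hUs hu) _) (hit u' (hUs hu') _) a1 b1 a2 b2
        obtain ⟨e1, e2⟩ := ih (j - 1) u hu u' hu' (by omega) (by omega) this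
        exact ⟨e1, by omega⟩
  let Q : PathPartition X.graph :=
    { ends := U
      len := len
      pt := fun u i => X.par^[i] u
      top := fun u => X.par^[len u + 1] u
      pt_zero := fun u _ => rfl
      top_mem := hlen
      inj := fun u hu u' hu' i hi j hj h => hinj i j u hu u' hu' hi hj h
      adj_succ := by
        intro u hu i hi
        obtain ⟨w, hw⟩ := X.mem_support.1 (hit u (hUs hu) i)
        obtain ⟨a1, a2⟩ := hchild u hu (i + 1) (by omega) hi
        simp only [Nat.add_sub_cancel] at a1 a2
        rw [← a1] at a2 ⊢
        exact X.graph_adj_par hw a2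
      adj_top := by
        intro u hu h0
        rw [Function.iterate_succ_apply']
        exact hadj _ (hit u (hUs hu) _) (hlt u _ h0 le_rfl)
      eq_of_adj := by
        intro u hu i hi h1 b hb
        rcases hb with ⟨w, h2, h3, h4, h5 | h5⟩ | ⟨w, w', h2, h3, -⟩
        · rw [← Function.iterate_succ_apply' X.par] at h5
          rcases hi.lt_or_eq with h | h
          · exact Or.inr (Or.inl ⟨h, h5⟩)
          · exact Or.inr (Or.inr (h ▸ h5))
        · left
          obtain ⟨a1, a2⟩ := hchild u hu i h1 hi
          exact hU _ _ _ (hlt u i h1 hi) (X.mem_support.2 ⟨w, h3⟩) (hit u (hUs hu) _) h5.symm a1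
            h4.symm a2
        · exact absurd (h3 ▸ hUp w w' h2) (hlt u i h1 hi) }
  have hcov : ∀ y ∈ U, ∀ i, ∃ u ∈ U, ∃ j ≤ len u, X.par^[i] y = X.par^[j] u := by
    intro y hy i
    induction i with
    | zero => exact ⟨y, hy, 0, Nat.zero_le _, rfl⟩
    | succ i ih =>
      obtain ⟨u, hu, j, hj, e⟩ := ih
      rw [Function.iterate_succ_apply', e, ← Function.iterate_succ_apply' X.par]
      rcases hj.lt_or_eq with h | rfl
      · exact ⟨u, hu, j + 1, h, rfl⟩
      · exact ⟨_, hlen u hu, 0, Nat.zero_le _, rfl⟩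
  refine ⟨Q, hUc, fun v => ⟨fun hv => ?_, ?_⟩, fun w => ⟨_, X.root_mem_tree w, hUr w⟩⟩
  · obtain ⟨w, hw⟩ := X.mem_support.1 hv
    rcases X.mem_tree.1 hw with rfl | ⟨w', h, i, rfl⟩
    · exact hcov _ (hUr w) 0
    · exact hcov _ (hUp w w' h) i
  · rintro ⟨u, hu, i, -, rfl⟩
    exact hit u (hUs hu) i

end RootedModel

end SimpleGraph

/-! ### Sparsity of shallow minors -/

namespace SimpleGraph

variable {V W : Type*}

theorem HasBalancedSplit.mono [Fintype W] [DecidableEq W] {H : SimpleGraph W} {k k' : ℝ}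
    (h : H.HasBalancedSplit k) (hk : k ≤ k') : H.HasBalancedSplit k' := by
  obtain ⟨S, A₁, A₂, h1, h2, h3⟩ := h
  exact ⟨S, A₁, A₂, h1, h2.trans hk, h3⟩

theorem IsShallowMinor.hasBalancedSplit_of_le [Finite V] [Fintype W] [DecidableEq W]
    {G : SimpleGraph V} {H : SimpleGraph W} {r : ℕ} (h : H.IsShallowMinor r G) {c x : ℝ}
    (hc : 0 ≤ c) (hx : 1 / 20 ≤ x) (hG : G.HasBalancedSeparators c x) :
    H.HasBalancedSplit (316 * c * (Fintype.card W + H.numDarts * r : ℝ) ^ x) := by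
  classical
  have := Fintype.ofFinite V
  obtain ⟨X⟩ := h.nonempty_rootedModel
  refine (X.model.hasBalancedSplit_of_hasSplits hc hx (hG.hasSplits X.graph_le)
    fun u v => X.mem_support_of_adj).mono ?_
  have : (#X.model.support : ℝ) ≤ Fintype.card W + H.numDarts * r := by
    exact_mod_cast X.card_support_le
  gcongr

theorem IsShallowMinor.hasBalancedSplit_of_pow [Finite V] [Fintype W] [DecidableEq W]
    {G : SimpleGraph V} {H : SimpleGraph W} {r : ℕ} (h : H.IsShallowMinor r G) {c x : ℝ}
    (hc : 0 ≤ c) (hx : 0 ≤ x) (hG : G.HasBalancedSeparators c x) {T : ℕ}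
    (hT : 4 * (Fintype.card W + Fintype.card W ^ 3 : ℝ) < (3 / 2 : ℝ) ^ T) :
    H.HasBalancedSplit (3 * T * (c * (Fintype.card W + H.numDarts * r : ℝ) ^ x)) := by
  classical
  have := Fintype.ofFinite V
  obtain ⟨X⟩ := h.nonempty_rootedModel
  obtain ⟨Q, hQc, hQ, hz⟩ := X.exists_pathPartition
  have hQc' : (#Q.ends : ℝ) ≤ Fintype.card W + Fintype.card W ^ 3 := by exact_mod_cast hQc
  refine (X.model.hasBalancedSplit_of_pathPartition Q hc hx (hG.hasSplits X.graph_le)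
    (fun u v => X.mem_support_of_adj) hQ hz (T := T) (by linarith)).mono ?_
  have : (#X.model.support : ℝ) ≤ Fintype.card W + H.numDarts * r := by
    exact_mod_cast X.card_support_le
  gcongr

/-- The number of ordered pairs of adjacent vertices of `A`. -/
noncomputable def dartsIn (H : SimpleGraph W) (A : Finset W) : ℕ :=
  {p : W × W | p.1 ∈ A ∧ p.2 ∈ A ∧ H.Adj p.1 p.2}.ncard

theorem dartsIn_univ [Fintype W] (H : SimpleGraph W) : H.dartsIn univ = H.numDarts := by
  simp [dartsIn, numDarts]

theorem dartsIn_add_card_le [DecidableEq W] (H : SimpleGraph W) (A : Finset W) :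
    H.dartsIn A + #A ≤ #A ^ 2 := by
  have h : H.dartsIn A ≤ #A.offDiag := by
    rw [← Set.ncard_coe_finset]
    refine Set.ncard_le_ncard ?_ (Finset.finite_toSet _)
    rintro p ⟨h1, h2, h3⟩
    simp only [Finset.mem_coe, Finset.mem_offDiag]
    exact ⟨h1, h2, h3.ne⟩
  rw [Finset.offDiag_card] at h
  have : #A ≤ #A * #A := Nat.le_mul_self _
  rw [sq]
  omega

theorem dartsIn_induce (H : SimpleGraph W) (P : Finset W) (A : Finset (P : Set W)) :
    (H.induce (P : Set W)).dartsIn A = H.dartsIn (A.map (Function.Embedding.subtype _)) := by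
  rw [dartsIn, dartsIn, ← Set.ncard_image_of_injective _
    (Function.Injective.prodMap Subtype.val_injective Subtype.val_injective)]
  congr 1
  ext ⟨a, b⟩
  simp only [Set.mem_image, Set.mem_ofPred_eq, Prod.exists, Prod.map_apply, Prod.mk.injEq,
    Finset.mem_map, Function.Embedding.subtype_apply, comap_adj]
  constructor
  · rintro ⟨x, y, ⟨h1, h2, h3⟩, rfl, rfl⟩
    exact ⟨⟨x, h1, rfl⟩, ⟨y, h2, rfl⟩, h3⟩
  · rintro ⟨⟨x, h1, rfl⟩, ⟨y, h2, rfl⟩, h3⟩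
    exact ⟨x, y, ⟨h1, h2, h3⟩, rfl, rfl⟩

theorem IsShallowMinor.mono {X : Type*} {G : SimpleGraph V} {H : SimpleGraph W} {H' : SimpleGraph X}
    {r : ℕ} (h : H.IsShallowMinor r G) (f : X → W) (hf : Function.Injective f)
    (hadj : ∀ a b, H'.Adj a b → H.Adj (f a) (f b)) : H'.IsShallowMinor r G := by
  obtain ⟨B, h1, h2, h3⟩ := h
  exact ⟨fun w => B (f w), fun w => h1 _, fun w w' hw => h2 _ _ (hf.ne hw),
    fun w w' hw => h3 _ _ (hadj _ _ hw)⟩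

/-- Few random samples hit every member of a family of dense subsets. -/
theorem exists_hitting_samples {α ι : Type*} [DecidableEq α] [DecidableEq ι] (E : Finset α)
    (hE : E.Nonempty) (J : Finset ι) (C : ι → Finset α) {η : ℝ} {q : ℕ}
    (hC : ∀ j ∈ J, C j ⊆ E ∧ η * #E ≤ #(C j)) (hq : #J * (1 - η) ^ q < 1) :
    ∃ f : Fin q → α, (∀ i, f i ∈ E) ∧ ∀ j ∈ J, ∃ i, f i ∈ C j := by
  by_contra hcon
  push Not at hcon
  -- A union bound by counting: if every sample fails, all `#E ^ q` samples are covered by those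
  -- that miss some `C j`, at most `((1 - η) #E) ^ q` for each `j`.
  have hsub : Fintype.piFinset (fun _ : Fin q => E) ⊆
      J.biUnion fun j => Fintype.piFinset fun _ : Fin q => E \ C j := by
    intro f hf
    rw [Fintype.mem_piFinset] at hf
    obtain ⟨j, hj, hfj⟩ := hcon f hf
    rw [Finset.mem_biUnion]
    exact ⟨j, hj, Fintype.mem_piFinset.2 fun i => Finset.mem_sdiff.2 ⟨hf i, hfj i⟩⟩
  have h1 := (Finset.card_le_card hsub).trans Finset.card_biUnion_le
  simp only [Fintype.card_piFinset_const] at h1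
  have h2 : (#E : ℝ) ^ q ≤ ∑ j ∈ J, (#(E \ C j) : ℝ) ^ q := by exact_mod_cast h1
  have h3 : ∀ j ∈ J, (#(E \ C j) : ℝ) ^ q ≤ ((1 - η) * #E) ^ q := by
    intro j hj
    have := Finset.card_sdiff_add_card_eq_card (hC j hj).1
    have h4 : (#(E \ C j) : ℝ) + #(C j) = #E := by exact_mod_cast this
    have := (hC j hj).2
    exact pow_le_pow_left₀ (by positivity) (by linarith) q
  have h4 := h2.trans (Finset.sum_le_sum h3)
  rw [Finset.sum_const, nsmul_eq_mul, mul_pow, ← mul_assoc] at h4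
  have h5 : (0 : ℝ) < (#E : ℝ) ^ q := by
    have : (0 : ℝ) < #E := by exact_mod_cast hE.card_pos
    positivity
  nlinarith

/-- A graph whose induced subgraphs are relatively sparse has a spanning subgraph with linearly many
edges that has no small balanced split. -/
theorem exists_sparse_not_hasBalancedSplit [Fintype W] [DecidableEq W] (H : SimpleGraph W)
    {ε : ℝ} (hε : 0 < ε) (hε1 : ε ≤ 1) (hd : 0 < H.numDarts)
    (hmax : ∀ A : Finset W,
      (H.dartsIn A : ℝ) ≤ H.numDarts * ((#A : ℝ) / Fintype.card W) ^ (1 + ε))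
    {q : ℕ} (hq : (3 : ℝ) ^ Fintype.card W * (1 - ε / 4) ^ q < 1) :
    ∃ Y ≤ H, Y.numDarts ≤ 2 * q ∧ ¬ Y.HasBalancedSplit (ε * Fintype.card W / 100) := by
  classical
  let E : Finset (W × W) := univ.filter fun p => H.Adj p.1 p.2
  have hEm : ∀ p, p ∈ E ↔ H.Adj p.1 p.2 := fun p => by simp [E]
  have hE : #E = H.numDarts := by
    rw [numDarts, ← Set.ncard_coe_finset]; congr 1; ext p; simp [E]
  -- A colouring encodes a candidate split, with `0` and `1` for the sides and `2` for the
  -- separator. `C σ` collects the darts it cuts, and the samples hit it whenever it is dense.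
  let C : (W → Fin 3) → Finset (W × W) := fun σ =>
    E.filter fun p => (σ p.1 = 0 ∧ σ p.2 = 1) ∨ (σ p.1 = 1 ∧ σ p.2 = 0)
  let J : Finset (W → Fin 3) := univ.filter fun σ => ε / 4 * #E ≤ #(C σ)
  have hJ : (#J : ℝ) ≤ 3 ^ Fintype.card W := by
    have : #J ≤ 3 ^ Fintype.card W := by
      refine (Finset.card_filter_le _ _).trans ?_
      simp
    exact_mod_cast this
  obtain ⟨f, hfE, hf⟩ := exists_hitting_samples E (Finset.card_pos.1 (hE ▸ hd)) J C
    (η := ε / 4) (q := q)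
    (fun σ hσ => ⟨Finset.filter_subset _ _, (Finset.mem_filter.1 hσ).2⟩)
    (lt_of_le_of_lt (by have : (0 : ℝ) ≤ (1 - ε / 4) ^ q := pow_nonneg (by linarith) q
                        gcongr) hq)
  let Y : SimpleGraph W :=
    { Adj := fun a b => (∃ i, f i = (a, b)) ∨ ∃ i, f i = (b, a)
      symm := ⟨fun a b h => h.symm⟩
      loopless := ⟨by
        rintro a (⟨i, hi⟩ | ⟨i, hi⟩) <;>
        · have := (hEm _).1 (hfE i)
          rw [hi] at this
          exact this.ne rfl⟩ }
  refine ⟨Y, ?_, ?_, ?_⟩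
  · rintro a b (⟨i, hi⟩ | ⟨i, hi⟩)
    · have := (hEm _).1 (hfE i); rwa [hi] at this
    · have := (hEm _).1 (hfE i); rw [hi] at this; exact this.symm
  · have hsub : {p : W × W | Y.Adj p.1 p.2} ⊆
        ((univ.image f ∪ univ.image fun i => (f i).swap : Finset (W × W)) : Set (W × W)) := by
      rintro ⟨a, b⟩ (⟨i, hi⟩ | ⟨i, hi⟩)
      · simp only [Finset.coe_union, Set.mem_union, Finset.mem_coe, Finset.mem_image,
          Finset.mem_univ, true_and]
        exact Or.inl ⟨i, hi⟩
      · simp only [Finset.coe_union, Set.mem_union, Finset.mem_coe, Finset.mem_image,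
          Finset.mem_univ, true_and]
        exact Or.inr ⟨i, by rw [hi]; rfl⟩
    have h1 := Set.ncard_le_ncard hsub (Finset.finite_toSet _)
    rw [Set.ncard_coe_finset] at h1
    refine h1.trans ((Finset.card_union_le _ _).trans ?_)
    have h2 := Finset.card_image_le (s := (univ : Finset (Fin q))) (f := f)
    have h3 := Finset.card_image_le (s := (univ : Finset (Fin q))) (f := fun i => (f i).swap)
    simp only [Finset.card_univ, Fintype.card_fin] at h2 h3
    omega
  · rintro ⟨S, A₁, A₂, hs, hS, h1, h2⟩
    have d0 := Finset.disjoint_left.1 hs.disj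
    let σ : W → Fin 3 := fun w => if w ∈ A₁ then 0 else if w ∈ A₂ then 1 else 2
    have hσ0 : ∀ w, σ w = 0 → w ∈ A₁ := by
      intro w h
      by_contra hn
      by_cases h' : w ∈ A₂ <;> simp [σ, hn, h'] at h
    have hσ1 : ∀ w, σ w = 1 → w ∈ A₂ := by
      intro w h
      by_contra hn
      by_cases h' : w ∈ A₁ <;> simp [σ, hn, h'] at h
    have hσ0' : ∀ w ∈ A₁, σ w = 0 := fun w h => by simp [σ, h]
    have hσ1' : ∀ w ∈ A₂, σ w = 1 := fun w h => by
      have : w ∉ A₁ := fun h' => d0 h' h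
      simp [σ, h, this]
    have hC : (#(C σ) : ℝ) < ε / 4 * #E := by
      by_contra hcon
      obtain ⟨i, hi⟩ := hf σ (Finset.mem_filter.2 ⟨Finset.mem_univ _, not_lt.1 hcon⟩)
      rcases (Finset.mem_filter.1 hi).2 with h | h
      · exact hs.not_adj _ (hσ0 _ h.1) _ (hσ1 _ h.2) (Or.inl ⟨i, rfl⟩)
      · exact hs.not_adj _ (hσ0 _ h.2) _ (hσ1 _ h.1) (Or.inr ⟨i, rfl⟩)
    have hcov : ∀ w, w ∈ A₁ ∨ w ∈ A₂ ∨ w ∈ S := by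
      intro w
      have : w ∈ A₁ ∪ A₂ ∪ S := by rw [hs.cover]; simp
      simp only [Finset.mem_union] at this
      tauto
    have hEle : #E ≤ H.dartsIn (A₁ ∪ S) + H.dartsIn (A₂ ∪ S) + #(C σ) := by
      rw [dartsIn, dartsIn, ← Set.ncard_coe_finset, ← Set.ncard_coe_finset]
      refine le_trans (Set.ncard_le_ncard ?_ (Set.toFinite _)) ((Set.ncard_union_le _ _).trans
        (add_le_add_left (Set.ncard_union_le _ _) _))
      rintro ⟨a, b⟩ hab
      have hadj : H.Adj a b := (hEm _).1 (Finset.mem_coe.1 hab)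
      simp only [Set.mem_union, Set.mem_ofPred_eq, Finset.mem_coe, Finset.mem_union, C,
        Finset.mem_filter, hEm]
      rcases hcov a with ha | ha | ha <;> rcases hcov b with hb | hb | hb
      · exact Or.inl (Or.inl ⟨Or.inl ha, Or.inl hb, hadj⟩)
      · exact Or.inr ⟨hadj, Or.inl ⟨hσ0' a ha, hσ1' b hb⟩⟩
      · exact Or.inl (Or.inl ⟨Or.inl ha, Or.inr hb, hadj⟩)
      · exact Or.inr ⟨hadj, Or.inr ⟨hσ1' a ha, hσ0' b hb⟩⟩
      · exact Or.inl (Or.inr ⟨Or.inl ha, Or.inl hb, hadj⟩)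
      · exact Or.inl (Or.inr ⟨Or.inl ha, Or.inr hb, hadj⟩)
      · exact Or.inl (Or.inl ⟨Or.inr ha, Or.inl hb, hadj⟩)
      · exact Or.inl (Or.inr ⟨Or.inr ha, Or.inl hb, hadj⟩)
      · exact Or.inl (Or.inl ⟨Or.inr ha, Or.inr hb, hadj⟩)
    have hW : Nonempty W := by
      obtain ⟨p, -⟩ := Finset.card_pos.1 (hE ▸ hd)
      exact ⟨p.1⟩
    have hn : (0 : ℝ) < Fintype.card W := by exact_mod_cast Fintype.card_pos
    have hd' : (0 : ℝ) < H.numDarts := by exact_mod_cast hd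
    set n : ℝ := ((Fintype.card W : ℕ) : ℝ)
    have hE2 : (#E : ℝ) ≤ H.dartsIn (A₁ ∪ S) + H.dartsIn (A₂ ∪ S) + #(C σ) := by
      exact_mod_cast hEle
    rw [hE] at hE2 hC
    -- A side together with `S` has at most `(2/3 + 1/100) n ≤ 0.68 n` vertices, and Bernoulli's
    -- inequality gives `0.68 ^ ε ≤ 1 - 0.32 ε`.
    have key : ∀ A : Finset W, (#A : ℝ) ≤ 2 * n / 3 →
        (H.dartsIn (A ∪ S) : ℝ) ≤ H.numDarts * ((#(A ∪ S) / n) * (1 - 0.32 * ε)) := by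
      intro A hA
      refine (hmax (A ∪ S)).trans ?_
      have hc : (#(A ∪ S) : ℝ) ≤ #A + #S := by exact_mod_cast Finset.card_union_le _ _
      have hα : (#(A ∪ S) : ℝ) / n ≤ 1 + (-0.32) := by
        rw [div_le_iff₀ hn]
        nlinarith
      have hα0 : (0 : ℝ) ≤ #(A ∪ S) / n := by positivity
      have hb := rpow_one_add_le_one_add_mul_self (s := -0.32) (by norm_num) hε.le hε1
      rw [Real.rpow_one_add' hα0 (by linarith)]
      gcongr
      calc ((#(A ∪ S) : ℝ) / n) ^ ε ≤ (1 + (-0.32)) ^ ε := Real.rpow_le_rpow hα0 hα hε.le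
        _ ≤ 1 - 0.32 * ε := by linarith
    have k1 := key A₁ h1
    have k2 := key A₂ h2
    have hsum : (#(A₁ ∪ S) : ℝ) / n + #(A₂ ∪ S) / n ≤ 1 + ε / 100 := by
      rw [← add_div, div_le_iff₀ hn]
      have e1 : #(A₁ ∪ S) = #A₁ + #S := Finset.card_union_of_disjoint hs.disj_left
      have e2 : #(A₂ ∪ S) = #A₂ + #S := Finset.card_union_of_disjoint hs.disj_right
      have e3 : #A₁ + #A₂ + #S = Fintype.card W := by
        rw [← Finset.card_univ, ← hs.cover, Finset.card_union_of_disjoint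
          (Finset.disjoint_union_left.2 ⟨hs.disj_left, hs.disj_right⟩),
          Finset.card_union_of_disjoint hs.disj]
      have e4 : (#A₁ : ℝ) + #A₂ + #S = n := by
        change (#A₁ : ℝ) + #A₂ + #S = ((Fintype.card W : ℕ) : ℝ)
        exact_mod_cast e3
      rw [e1, e2]
      push_cast
      linarith
    -- Uncut darts make up at most `(1 + ε/100)(1 - 0.32 ε)` of all darts. With the cut ones, fewer
    -- than `ε/4`, this stays below `1`.
    have h3 : (H.numDarts : ℝ) < H.numDarts *
        (((#(A₁ ∪ S) : ℝ) / n + #(A₂ ∪ S) / n) * (1 - 0.32 * ε) + ε / 4) := by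
      linarith
    have h4 : 1 < ((#(A₁ ∪ S) : ℝ) / n + #(A₂ ∪ S) / n) * (1 - 0.32 * ε) + ε / 4 := by
      by_contra hcon
      have := mul_le_mul_of_nonneg_left (not_lt.1 hcon) hd'.le
      linarith
    have h5 : ((#(A₁ ∪ S) : ℝ) / n + #(A₂ ∪ S) / n) * (1 - 0.32 * ε) ≤
        (1 + ε / 100) * (1 - 0.32 * ε) := by
      gcongr
      linarith
    nlinarith

/-- The bounds `1 - ε/4 ≤ exp (-ε/4)` and `3 < exp 2` suffice. -/
theorem three_pow_mul_lt_one {n q : ℕ} {ε : ℝ} (hn : 0 < n) (hε : 0 < ε) (hε1 : ε ≤ 1)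
    (hq : 8 * n / ε ≤ q) : (3 : ℝ) ^ n * (1 - ε / 4) ^ q < 1 := by
  have h1 : (1 - ε / 4) ^ q ≤ Real.exp (-(2 * n)) := by
    calc (1 - ε / 4) ^ q ≤ Real.exp (-(ε / 4)) ^ q :=
          pow_le_pow_left₀ (by linarith) (Real.one_sub_le_exp_neg _) q
      _ = Real.exp (q * -(ε / 4)) := by rw [← Real.exp_nat_mul]
      _ ≤ Real.exp (-(2 * n)) := by
          apply Real.exp_le_exp.2
          rw [div_le_iff₀ hε] at hq
          linarith
  have h2 : (3 : ℝ) < Real.exp 2 := by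
    have := Real.add_one_lt_exp (x := 2) (by norm_num)
    linarith
  calc (3 : ℝ) ^ n * (1 - ε / 4) ^ q ≤ (3 : ℝ) ^ n * Real.exp (-(2 * n)) := by gcongr
    _ < Real.exp 2 ^ n * Real.exp (-(2 * n)) := by
        have := pow_lt_pow_left₀ h2 (by norm_num) hn.ne'
        have := Real.exp_pos (-(2 * n : ℝ))
        gcongr
    _ = 1 := by
        rw [← Real.exp_nat_mul, ← Real.exp_add]
        ring_nf
        simp

/-- Shallow minors of graphs with strongly sublinear separators are sparse. -/
theorem IsShallowMinor.dartsIn_le [Finite V] [Fintype W] [DecidableEq W]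
    {G : SimpleGraph V} {H : SimpleGraph W} {r : ℕ} (h : H.IsShallowMinor r G) (hr : 1 ≤ r)
    {c x ε τ : ℝ} (hc : 0 ≤ c) (hx : 1 / 20 ≤ x) (hG : G.HasBalancedSeparators c x)
    (hε : 0 < ε) (hε1 : ε ≤ 1) (hτ : 0 ≤ τ)
    (hn : ∀ n : ℝ, 1 ≤ n → τ < n → 316 * c * (19 * r * n / ε) ^ x ≤ ε * n / 100) (A : Finset W) :
    (H.dartsIn A : ℝ) ≤ τ * (#A : ℝ) ^ (1 + ε) := by
  classical
  rcases A.eq_empty_or_nonempty with rfl | hA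
  · have : H.dartsIn (∅ : Finset W) = 0 := by simp [dartsIn]
    rw [this]
    push_cast
    positivity
  by_contra hcon
  -- Maximality of this normalised density is precisely the relative sparsity that the sampling
  -- lemma needs inside `P`.
  obtain ⟨P, hP, hPmax⟩ := Finset.exists_max_image (univ.filter fun P : Finset W => P.Nonempty)
    (fun P => (H.dartsIn P : ℝ) / (#P : ℝ) ^ (1 + ε)) ⟨A, by simp [hA]⟩
  have hPne : P.Nonempty := by simpa using hP
  have hP0 : (0 : ℝ) < #P := by exact_mod_cast hPne.card_pos
  have hP1 : (1 : ℝ) ≤ #P := by exact_mod_cast hPne.card_pos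
  have hPp : (0 : ℝ) < (#P : ℝ) ^ (1 + ε) := by positivity
  have hτP : τ * (#P : ℝ) ^ (1 + ε) < H.dartsIn P := by
    have h1 := hPmax A (by simp [hA])
    have hA0 : (0 : ℝ) < #A := by exact_mod_cast hA.card_pos
    have h2 : τ < (H.dartsIn A : ℝ) / (#A : ℝ) ^ (1 + ε) := by
      rw [lt_div_iff₀ (by positivity)]; exact not_le.1 hcon
    rw [← lt_div_iff₀ hPp]
    exact h2.trans_le h1
  have hτlt : τ < #P := by
    have h1 : (H.dartsIn P : ℝ) + #P ≤ (#P : ℝ) ^ 2 := by exact_mod_cast H.dartsIn_add_card_le P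
    have h2 : (#P : ℝ) ≤ (#P : ℝ) ^ (1 + ε) := by
      calc (#P : ℝ) = (#P : ℝ) ^ (1 : ℝ) := (Real.rpow_one _).symm
        _ ≤ _ := Real.rpow_le_rpow_of_exponent_le hP1 (by linarith)
    have h3 : τ * #P ≤ τ * (#P : ℝ) ^ (1 + ε) := by gcongr
    nlinarith
  let HP := H.induce (P : Set W)
  have hcard : Fintype.card (P : Set W) = #P := by simp
  have hdP : HP.numDarts = H.dartsIn P := by
    rw [← dartsIn_univ, dartsIn_induce]
    congr 1
    ext v
    simp
  have hdpos : 0 < HP.numDarts := by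
    rw [hdP]
    have : (0 : ℝ) < H.dartsIn P := lt_of_le_of_lt (by positivity) hτP
    exact_mod_cast this
  obtain ⟨Y, hY, hYd, hYs⟩ := exists_sparse_not_hasBalancedSplit HP hε hε1 hdpos (by
    intro B
    rw [dartsIn_induce, hdP, hcard]
    rcases B.eq_empty_or_nonempty with rfl | hB
    · have : H.dartsIn (∅ : Finset W) = 0 := by simp [dartsIn]
      rw [Finset.map_empty, this]
      push_cast
      positivity
    have h1 := hPmax (B.map (Function.Embedding.subtype _)) (by simp [hB])
    rw [Finset.card_map] at h1
    have hB0 : (0 : ℝ) < #B := by exact_mod_cast hB.card_pos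
    rw [Real.div_rpow hB0.le hP0.le]
    rw [div_le_iff₀ (by positivity)] at h1
    calc _ ≤ _ := h1
      _ = _ := by ring) (q := ⌈8 * (#P : ℝ) / ε⌉₊) (by
    refine three_pow_mul_lt_one (by rw [hcard]; exact hPne.card_pos) hε hε1 ?_
    rw [hcard]
    exact Nat.le_ceil _)
  apply hYs
  have hYG : Y.IsShallowMinor r G := h.mono Subtype.val Subtype.val_injective
    (fun a b hab => hY hab)
  refine (hYG.hasBalancedSplit_of_le hc hx hG).mono ?_
  rw [hcard]
  refine le_trans ?_ (hn #P hP1 hτlt)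
  have hr' : (1 : ℝ) ≤ r := by exact_mod_cast hr
  have h1 : (Y.numDarts : ℝ) ≤ 2 * ⌈8 * (#P : ℝ) / ε⌉₊ := by exact_mod_cast hYd
  have h2 : (⌈8 * (#P : ℝ) / ε⌉₊ : ℝ) < 8 * (#P : ℝ) / ε + 1 := Nat.ceil_lt_add_one (by positivity)
  have h3 : 1 ≤ (#P : ℝ) / ε := by rw [le_div_iff₀ hε]; linarith
  have h4 : (#P : ℝ) ≤ (#P : ℝ) / ε := by rw [le_div_iff₀ hε]; nlinarith
  -- The samples give `16 |P| / ε`, and rounding up adds `2 ≤ 2 |P| / ε`.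
  have h5 : (Y.numDarts : ℝ) ≤ 18 * (#P / ε) := by
    have : 8 * (#P : ℝ) / ε = 8 * (#P / ε) := by ring
    linarith
  gcongr
  calc (#P : ℝ) + Y.numDarts * r ≤ (#P / ε) * r + 18 * (#P / ε) * r := by
        gcongr
        nlinarith
    _ = 19 * r * #P / ε := by ring

end SimpleGraph

/-! ### Estimates for the parameters -/

theorem sepEps_pos {δ : ℝ} (h0 : 0 < δ) (h1 : δ ≤ 1) : 0 < sepEps δ := by
  unfold sepEps
  split_ifs with h
  · exact one_pos
  · have : 0 < 1 - δ := by linarith [lt_of_le_of_ne h1 h]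
    positivity

theorem sepEps_le_one (δ : ℝ) : sepEps δ ≤ 1 := by
  unfold sepEps
  split_ifs
  · exact le_rfl
  · exact min_le_left _ _

/-- The edge bound `n ^ (1 + ε)` costs `ε (1 - δ)` in the exponent, and `ε` is chosen to keep this
at most `δ / 6`. -/
theorem one_add_sepEps_mul_le {δ : ℝ} (h0 : 0 < δ) (h1 : δ ≤ 1) :
    (1 + sepEps δ) * (1 - δ) ≤ 1 - 5 / 6 * δ := by
  unfold sepEps
  split_ifs with h
  · rw [h]; norm_num
  · have h2 : 0 < 1 - δ := by linarith [lt_of_le_of_ne h1 h]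
    have h3 : min 1 (δ / (6 * (1 - δ))) * (1 - δ) ≤ δ / (6 * (1 - δ)) * (1 - δ) := by
      gcongr
      exact min_le_right _ _
    have h4 : δ / (6 * (1 - δ)) * (1 - δ) = δ / 6 := by field_simp
    linarith

theorem exists_even_between (y : ℝ) (hy : 0 ≤ y) : ∃ t : ℕ, Even t ∧ y < t ∧ (t : ℝ) ≤ y + 2 := by
  refine ⟨2 * (⌊y / 2⌋₊ + 1), even_two_mul _, ?_, ?_⟩
  · have := Nat.lt_floor_add_one (y / 2)
    push_cast
    linarith
  · have := Nat.floor_le (by positivity : 0 ≤ y / 2)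
    push_cast
    linarith

theorem lt_sepT (n₀ : ℕ) (c δ ε : ℝ) (r : ℕ) :
    max (n₀ : ℝ) ((42000 * c * 4 ^ sepM ε * (r : ℝ)) ^ (1 / δ)) < sepT n₀ c δ ε r := by
  obtain ⟨t, h1, h2, -⟩ := exists_even_between
    (max (n₀ : ℝ) ((42000 * c * 4 ^ sepM ε * (r : ℝ)) ^ (1 / δ))) (le_max_of_le_left (by positivity))
  exact (Nat.sInf_mem (s := {t : ℕ | Even t ∧
    max (n₀ : ℝ) ((42000 * c * 4 ^ sepM ε * (r : ℝ)) ^ (1 / δ)) < (t : ℝ)}) ⟨t, h1, h2⟩).2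

theorem sepT_le (n₀ : ℕ) (c δ ε : ℝ) (r : ℕ) :
    (sepT n₀ c δ ε r : ℝ) ≤
      max (n₀ : ℝ) ((42000 * c * 4 ^ sepM ε * (r : ℝ)) ^ (1 / δ)) + 2 := by
  obtain ⟨t, h1, h2, h3⟩ := exists_even_between
    (max (n₀ : ℝ) ((42000 * c * 4 ^ sepM ε * (r : ℝ)) ^ (1 / δ))) (le_max_of_le_left (by positivity))
  have : sepT n₀ c δ ε r ≤ t := Nat.sInf_le ⟨h1, h2⟩
  exact le_trans (by exact_mod_cast this) h3

theorem lt_sepT_rpow {n₀ : ℕ} {c δ ε : ℝ} {r : ℕ} (hc : 0 ≤ c) (hδ : 0 < δ) :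
    42000 * c * 4 ^ sepM ε * (r : ℝ) < (sepT n₀ c δ ε r : ℝ) ^ δ := by
  have h := (le_max_right _ _).trans_lt (lt_sepT n₀ c δ ε r)
  have h0 : 0 ≤ 42000 * c * 4 ^ sepM ε * (r : ℝ) := by positivity
  have := Real.rpow_lt_rpow (by positivity) h hδ
  rwa [← Real.rpow_mul h0, one_div_mul_cancel hδ.ne', Real.rpow_one] at this

theorem one_le_sepT (n₀ : ℕ) (c δ ε : ℝ) (r : ℕ) : (1 : ℝ) ≤ sepT n₀ c δ ε r := by
  have h : (0 : ℝ) < sepT n₀ c δ ε r :=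
    ((Nat.cast_nonneg n₀).trans (le_max_left _ _)).trans_lt (lt_sepT n₀ c δ ε r)
  have : 0 < sepT n₀ c δ ε r := by exact_mod_cast h
  exact_mod_cast this

theorem sepT_sq_add_one_le_sepB (n₀ : ℕ) (c δ ε : ℝ) (r : ℕ) :
    (sepT n₀ c δ ε r : ℝ) ^ 2 + 1 ≤ sepB n₀ c δ ε r := by
  unfold sepB
  have ht := one_le_sepT n₀ c δ ε r
  set t : ℝ := (sepT n₀ c δ ε r : ℝ)
  have h1 : (1 : ℝ) ≤ 32 ^ sepM ε := one_le_pow₀ (by norm_num)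
  have h2 : t ^ 2 ≤ t ^ 4 := pow_le_pow_right₀ ht (by norm_num)
  have h3 : 1 ≤ t ^ 2 := one_le_pow₀ ht
  have h4 : 1 * t ^ 4 ≤ 32 ^ sepM ε * t ^ 4 := by gcongr
  linarith

theorem one_le_sepB (n₀ : ℕ) (c δ ε : ℝ) (r : ℕ) : 1 ≤ sepB n₀ c δ ε r := by
  have := sepT_sq_add_one_le_sepB n₀ c δ ε r
  have : (0 : ℝ) ≤ (sepT n₀ c δ ε r : ℝ) ^ 2 := by positivity
  linarith

/-- From `n > t²` one gets `n ^ δ ≥ (42000 c 4^m r)²`. Since `m ≥ 1 / (2 ε²)`, also `16^m ε² ≥ 1/2`,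
which absorbs both factors `1/ε`. -/
theorem separator_order_le_of_sepT_sq_lt {n₀ : ℕ} {c δ ε : ℝ} {r : ℕ} (hc : 1 ≤ c) (hδ : 0 < δ)
    (hε : 0 < ε) (hε1 : ε ≤ 1) (hr : 1 ≤ r) {n : ℝ} (hn : 1 ≤ n)
    (hnt : (sepT n₀ c δ ε r : ℝ) ^ 2 < n) :
    316 * c * (19 * r * n / ε) ^ (1 - δ) ≤ ε * n / 100 := by
  have hr' : (1 : ℝ) ≤ r := by exact_mod_cast hr
  have ht := one_le_sepT n₀ c δ ε r
  have hz := lt_sepT_rpow (n₀ := n₀) (ε := ε) (r := r) (zero_le_one.trans hc) hδ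
  set t : ℝ := (sepT n₀ c δ ε r : ℝ)
  have hq : (4 : ℝ) ^ sepM ε * 4 ^ sepM ε * ε ^ 2 ≥ 1 / 2 := by
    have h1 : 1 / (2 * ε ^ 2) ≤ (sepM ε : ℝ) := Nat.le_ceil _
    have h2 : (sepM ε : ℝ) ≤ 4 ^ sepM ε := by
      exact_mod_cast (Nat.lt_pow_self (by norm_num : 1 < 4)).le
    have h3 : (1 : ℝ) ≤ 4 ^ sepM ε := one_le_pow₀ (by norm_num)
    rw [div_le_iff₀ (by positivity)] at h1
    have h4 : (sepM ε : ℝ) * ε ^ 2 ≤ 4 ^ sepM ε * ε ^ 2 := by gcongr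
    have h5 : 1 * (4 ^ sepM ε * ε ^ 2) ≤ 4 ^ sepM ε * (4 ^ sepM ε * ε ^ 2) := by gcongr
    nlinarith
  have hnδ : (42000 * c * 4 ^ sepM ε * (r : ℝ)) ^ 2 ≤ n ^ δ := by
    calc (42000 * c * 4 ^ sepM ε * (r : ℝ)) ^ 2 ≤ (t ^ δ) ^ 2 := by gcongr
      _ = (t ^ 2) ^ δ := by
          rw [← Real.rpow_natCast, ← Real.rpow_natCast, ← Real.rpow_mul (by positivity),
            ← Real.rpow_mul (by positivity), mul_comm]
      _ ≤ n ^ δ := by gcongr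
  have h1 : 316 * c * (19 * r / ε) ≤ ε / 100 * n ^ δ := by
    have h2 : 316 * c * (19 * r / ε) = 6004 * (c * r) / ε := by ring
    rw [h2, div_le_iff₀ hε]
    have h3 : ε / 100 * (42000 * c * 4 ^ sepM ε * (r : ℝ)) ^ 2 * ε ≤ ε / 100 * n ^ δ * ε := by gcongr
    refine le_trans ?_ h3
    have h4 : ε / 100 * (42000 * c * 4 ^ sepM ε * (r : ℝ)) ^ 2 * ε =
        17640000 * (c * r) * (c * r) * ((4 : ℝ) ^ sepM ε * 4 ^ sepM ε * ε ^ 2) := by ring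
    rw [h4]
    have h5 : 1 ≤ c * r := one_le_mul_of_one_le_of_one_le hc hr'
    have h6 : 17640000 * (c * r) * (c * r) * (1 / 2) ≤
        17640000 * (c * r) * (c * r) * ((4 : ℝ) ^ sepM ε * 4 ^ sepM ε * ε ^ 2) := by gcongr
    nlinarith
  have hbase : 1 ≤ 19 * r / ε := by rw [le_div_iff₀ hε]; linarith
  have hn0 : 0 < n := by linarith
  calc 316 * c * (19 * r * n / ε) ^ (1 - δ)
      = 316 * c * ((19 * r / ε) ^ (1 - δ) * n ^ (1 - δ)) := by
        rw [← Real.mul_rpow (by positivity) hn0.le]; ring_nf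
    _ ≤ 316 * c * ((19 * r / ε) * n ^ (1 - δ)) := by
        gcongr
        calc (19 * r / ε : ℝ) ^ (1 - δ) ≤ (19 * r / ε) ^ (1 : ℝ) :=
              Real.rpow_le_rpow_of_exponent_le hbase (by linarith)
          _ = _ := Real.rpow_one _
    _ = 316 * c * (19 * r / ε) * n ^ (1 - δ) := by ring
    _ ≤ ε / 100 * n ^ δ * n ^ (1 - δ) := by gcongr
    _ = ε * n / 100 := by
        rw [mul_assoc, ← Real.rpow_add hn0]
        norm_num
        ring

theorem exists_pow_three_halves_gt {n : ℝ} (hn : 1 ≤ n) :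
    ∃ T : ℕ, 4 * (n + n ^ 3) < (3 / 2 : ℝ) ^ T ∧ (T : ℝ) ≤ 8 * Real.log n + 9 := by
  have hl := Real.log_nonneg hn
  have hn0 : 0 < n := by linarith
  refine ⟨⌈8 * Real.log n + 8⌉₊, ?_, ?_⟩
  · have h1 := Nat.le_ceil (8 * Real.log n + 8)
    set T := ⌈8 * Real.log n + 8⌉₊
    -- Hence `(3/2)^T ≥ exp (3 log n + 3) = e³ n³`, which exceeds `8 n³`.
    have he : Real.exp (2 / 5) ≤ 3 / 2 := by
      have h5 : Real.exp (2 / 5) ^ 5 ≤ (3 / 2) ^ 5 := by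
        rw [← Real.exp_nat_mul]
        have : ((5 : ℕ) : ℝ) * (2 / 5) = (2 : ℕ) * 1 := by norm_num
        rw [this, Real.exp_nat_mul]
        have := Real.exp_one_lt_d9
        have := Real.exp_pos 1
        nlinarith
      exact le_of_pow_le_pow_left₀ (by norm_num) (by norm_num) h5
    have h3 : Real.exp (3 * Real.log n + 3) ≤ (3 / 2 : ℝ) ^ T := by
      calc Real.exp (3 * Real.log n + 3) ≤ Real.exp (T * (2 / 5)) := by
            apply Real.exp_le_exp.2; linarith
        _ = Real.exp (2 / 5) ^ T := Real.exp_nat_mul _ _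
        _ ≤ _ := pow_le_pow_left₀ (Real.exp_pos _).le he T
    refine lt_of_lt_of_le ?_ h3
    have h4 : Real.exp (3 * Real.log n + 3) = n ^ 3 * Real.exp 1 ^ 3 := by
      rw [Real.exp_add, ← Real.exp_nat_mul]
      congr 1
      · have := Real.exp_nat_mul (Real.log n) 3
        rw [Real.exp_log hn0] at this
        exact_mod_cast this
      · norm_num
    rw [h4]
    have h5 : (2.7 : ℝ) ^ 3 ≤ Real.exp 1 ^ 3 :=
      pow_le_pow_left₀ (by norm_num) (by have := Real.exp_one_gt_d9; linarith) 3
    have h6 : n ≤ n ^ 3 := le_self_pow₀ hn (by norm_num)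
    have h7 : 0 < n ^ 3 := by positivity
    nlinarith
  · have := Nat.ceil_lt_add_one (by positivity : 0 ≤ 8 * Real.log n + 8)
    linarith

/-! ### Separators of shallow minors -/

namespace SimpleGraph

variable {V W : Type*}

theorem IsShallowMinor.finite [Finite V] {G : SimpleGraph V} {H : SimpleGraph W} {r : ℕ}
    (h : H.IsShallowMinor r G) : Finite W := by
  obtain ⟨X⟩ := h.nonempty_rootedModel
  refine Finite.of_injective X.root fun w w' hw => ?_
  by_contra hne
  exact Set.disjoint_left.1 (X.disj w w' hne) (X.root_mem w) (hw ▸ X.root_mem w')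

theorem IsShallowMinor.hasBalancedSplit_sepP [Finite V] [Fintype W] [DecidableEq W]
    {G : SimpleGraph V} {H : SimpleGraph W} {r : ℕ} (h : H.IsShallowMinor r G) (hr : 1 ≤ r)
    (n₀ : ℕ) {c δ : ℝ} (hc : 1 ≤ c) (hδ : 0 < δ) (hδ1 : δ ≤ 1)
    (hG : G.HasBalancedSeparators c (1 - δ)) :
    H.HasBalancedSplit (sepP n₀ c δ r * (Fintype.card W : ℝ) ^ (1 - 5 / 6 * δ)) := by
  have hr' : (1 : ℝ) ≤ r := by exact_mod_cast hr
  have hc0 : 0 ≤ c := by linarith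
  have hb := one_le_sepB n₀ c δ (sepEps δ) r
  have hbt := sepT_sq_add_one_le_sepB n₀ c δ (sepEps δ) r
  have hε := sepEps_pos hδ hδ1
  have hε1 := sepEps_le_one δ
  have hexp := one_add_sepEps_mul_le hδ hδ1
  have hsT := @separator_order_le_of_sepT_sq_lt n₀ c δ (sepEps δ) r hc hδ hε hε1 hr
  unfold sepP
  set b := sepB n₀ c δ (sepEps δ) r
  set ε := sepEps δ
  have hb0 : 0 ≤ b := by linarith
  rcases isEmpty_or_nonempty W with hW | hW
  · exact MinorModel.hasBalancedSplit_of_isEmpty H (by positivity)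
  have hn : (1 : ℝ) ≤ Fintype.card W := by exact_mod_cast Fintype.card_pos
  set n : ℝ := ((Fintype.card W : ℕ) : ℝ) with hndef
  have hn0 : 0 < n := by linarith
  -- As the exponent `1 - δ` tends to `0`, the sum of the geometric series is unbounded; counting
  -- rounds replaces it there.
  by_cases hx : 1 / 20 ≤ 1 - δ
  · have hd := h.dartsIn_le hr hc0 hx hG hε hε1 (by positivity) (fun n h1 h2 => hsT h1 h2) univ
    rw [dartsIn_univ, Finset.card_univ, ← hndef] at hd
    refine (h.hasBalancedSplit_of_le hc0 hx hG).mono ?_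
    rw [← hndef]
    have h1 : n ≤ n ^ (1 + ε) := by
      calc n = n ^ (1 : ℝ) := (Real.rpow_one _).symm
        _ ≤ _ := Real.rpow_le_rpow_of_exponent_le hn (by linarith)
    have h2 : n + H.numDarts * r ≤ b * r * n ^ (1 + ε) := by
      calc n + H.numDarts * r ≤ n ^ (1 + ε) * r +
            (sepT n₀ c δ ε r : ℝ) ^ 2 * n ^ (1 + ε) * r := by
            gcongr
            nlinarith
        _ = ((sepT n₀ c δ ε r : ℝ) ^ 2 + 1) * (r * n ^ (1 + ε)) := by ring
        _ ≤ b * (r * n ^ (1 + ε)) := by gcongr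
        _ = _ := by ring
    calc 316 * c * (n + H.numDarts * r) ^ (1 - δ)
        ≤ 316 * c * (b * r * n ^ (1 + ε)) ^ (1 - δ) := by gcongr
      _ = 316 * c * (b * r) ^ (1 - δ) * n ^ ((1 + ε) * (1 - δ)) := by
          rw [Real.mul_rpow (by positivity) (by positivity), ← Real.rpow_mul hn0.le]; ring
      _ ≤ 316 * c * (b * r) ^ (1 - δ) * n ^ (1 - 5 / 6 * δ) := by gcongr
  · have hx0 : 0 ≤ 1 - δ := by linarith
    obtain ⟨T, hT, hT'⟩ := exists_pow_three_halves_gt hn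
    refine (h.hasBalancedSplit_of_pow hc0 hx0 hG hT).mono ?_
    rw [← hndef]
    have hl := Real.log_nonneg hn
    have h1 : (H.numDarts : ℝ) + n ≤ n ^ 2 := by
      have := H.dartsIn_add_card_le univ
      rw [dartsIn_univ, Finset.card_univ] at this
      rw [hndef]
      exact_mod_cast this
    have h2 : n + H.numDarts * r ≤ n ^ 2 * r := by nlinarith
    -- The spare exponent `7/6 δ - 1` exceeds `1/10` because `δ > 19/20`, so it dominates `T ≤ 8 log
    -- n + 9`.
    have h3 : 3 * (T : ℝ) ≤ 316 * n ^ (1 - 5 / 6 * δ - 2 * (1 - δ)) := by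
      have h4 : 1 + Real.log n * (1 / 10) ≤ n ^ (1 - 5 / 6 * δ - 2 * (1 - δ)) := by
        rw [Real.rpow_def_of_pos hn0]
        calc 1 + Real.log n * (1 / 10) ≤ Real.exp (Real.log n * (1 / 10)) := by
              rw [add_comm]; exact Real.add_one_le_exp _
          _ ≤ _ := by
              apply Real.exp_le_exp.2
              gcongr
              linarith
      linarith
    calc 3 * T * (c * (n + H.numDarts * r) ^ (1 - δ))
        ≤ 3 * T * (c * (n ^ 2 * (1 * r)) ^ (1 - δ)) := by rw [one_mul]; gcongr
      _ ≤ 3 * T * (c * (n ^ 2 * (b * r)) ^ (1 - δ)) := by gcongr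
      _ = c * (b * r) ^ (1 - δ) * n ^ (2 * (1 - δ)) * (3 * T) := by
          rw [Real.mul_rpow (by positivity) (by positivity), ← Real.rpow_natCast,
            ← Real.rpow_mul hn0.le]
          push_cast
          ring
      _ ≤ c * (b * r) ^ (1 - δ) * n ^ (2 * (1 - δ)) *
            (316 * n ^ (1 - 5 / 6 * δ - 2 * (1 - δ))) := by gcongr
      _ = 316 * c * (b * r) ^ (1 - δ) * (n ^ (2 * (1 - δ)) *
            n ^ (1 - 5 / 6 * δ - 2 * (1 - δ))) := by ring
      _ = _ := by
          rw [← Real.rpow_add hn0]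
          congr 2
          ring

theorem IsShallowMinor.hasBalancedSeparators [Finite V] {G : SimpleGraph V} {H : SimpleGraph W}
    {r : ℕ} (h : H.IsShallowMinor r G) (hr : 1 ≤ r) (n₀ : ℕ) {c δ : ℝ} (hc : 1 ≤ c) (hδ : 0 < δ)
    (hδ1 : δ ≤ 1) (hG : G.HasBalancedSeparators c (1 - δ)) :
    H.HasBalancedSeparators (sepP n₀ c δ r) (1 - 5 / 6 * δ) := by
  classical
  intro J
  have hJ : J.coe.IsShallowMinor r G := h.mono Subtype.val Subtype.val_injective
    fun a b hab => J.adj_sub hab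
  have := hJ.finite
  have := Fintype.ofFinite J.verts
  rw [Nat.card_eq_fintype_card]
  exact (hJ.hasBalancedSplit_sepP hr n₀ hc hδ hδ1 hG).exists_isBalancedSeparator

end SimpleGraph

/-! ### Growth in `r` -/

theorem sepP_isBigO (n₀ : ℕ) {c δ : ℝ} (hc : 0 ≤ c) (hδ : 0 < δ) (hδ1 : δ ≤ 1) :
    Asymptotics.IsBigO Filter.atTop (fun r : ℕ => sepP n₀ c δ r)
      (fun r : ℕ => (r : ℝ) ^ (4 / δ)) := by
  set m := sepM (sepEps δ) with hm
  let B : ℝ := n₀ + (42000 * c * 4 ^ m) ^ (1 / δ) + 2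
  have hB : 0 ≤ B := by positivity
  let D : ℝ := 2 * 32 ^ m * B ^ 4
  have hD : 0 ≤ D := by positivity
  refine Asymptotics.IsBigO.of_bound (316 * c * D ^ (1 - δ)) ?_
  filter_upwards [Filter.eventually_ge_atTop 1] with r hr
  have hr' : (1 : ℝ) ≤ r := by exact_mod_cast hr
  have hr0 : (0 : ℝ) < r := by linarith
  have hb0 : 0 ≤ sepB n₀ c δ (sepEps δ) r := by unfold sepB; positivity
  have hp0 : 0 ≤ sepP n₀ c δ r := by unfold sepP; positivity
  rw [Real.norm_of_nonneg hp0, Real.norm_of_nonneg (by positivity)]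
  have ht : (sepT n₀ c δ (sepEps δ) r : ℝ) ≤ B * (r : ℝ) ^ (1 / δ) := by
    have h1 := sepT_le n₀ c δ (sepEps δ) r
    have h2 : (1 : ℝ) ≤ (r : ℝ) ^ (1 / δ) := Real.one_le_rpow hr' (by positivity)
    rw [← hm, Real.mul_rpow (by positivity) hr0.le] at h1
    have h3 : (0 : ℝ) ≤ (42000 * c * 4 ^ m) ^ (1 / δ) := by positivity
    have h4 : max (n₀ : ℝ) ((42000 * c * 4 ^ m) ^ (1 / δ) * (r : ℝ) ^ (1 / δ)) ≤
        n₀ * (r : ℝ) ^ (1 / δ) + (42000 * c * 4 ^ m) ^ (1 / δ) * (r : ℝ) ^ (1 / δ) := by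
      have h5 : (0 : ℝ) ≤ n₀ := Nat.cast_nonneg _
      apply max_le
      · have : (0 : ℝ) ≤ (42000 * c * 4 ^ m) ^ (1 / δ) * (r : ℝ) ^ (1 / δ) := by positivity
        nlinarith
      · have : (0 : ℝ) ≤ n₀ * (r : ℝ) ^ (1 / δ) := by positivity
        linarith
    change _ ≤ (n₀ + (42000 * c * 4 ^ m) ^ (1 / δ) + 2) * (r : ℝ) ^ (1 / δ)
    linarith
  -- `t` is at most of order `r ^ (1/δ)` and enters `b` to the fourth power.
  have hbr : sepB n₀ c δ (sepEps δ) r * r ≤ D * (r : ℝ) ^ (4 / δ + 1) := by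
    unfold sepB
    rw [← hm, Real.rpow_add hr0, Real.rpow_one]
    have h1 : (sepT n₀ c δ (sepEps δ) r : ℝ) ^ 4 ≤ B ^ 4 * (r : ℝ) ^ (4 / δ) := by
      calc (sepT n₀ c δ (sepEps δ) r : ℝ) ^ 4 ≤ (B * (r : ℝ) ^ (1 / δ)) ^ 4 := by gcongr
        _ = B ^ 4 * (r : ℝ) ^ (4 / δ) := by
            rw [mul_pow, ← Real.rpow_natCast ((r : ℝ) ^ (1 / δ)), ← Real.rpow_mul hr0.le]
            congr 2
            push_cast
            ring
    calc 2 * 32 ^ m * (sepT n₀ c δ (sepEps δ) r : ℝ) ^ 4 * r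
        ≤ 2 * 32 ^ m * (B ^ 4 * (r : ℝ) ^ (4 / δ)) * r := by gcongr
      _ = _ := by simp only [D]; ring
  have hx : 0 ≤ 1 - δ := by linarith
  unfold sepP
  calc 316 * c * (sepB n₀ c δ (sepEps δ) r * r) ^ (1 - δ)
      ≤ 316 * c * (D * (r : ℝ) ^ (4 / δ + 1)) ^ (1 - δ) := by gcongr
    _ = 316 * c * D ^ (1 - δ) * (r : ℝ) ^ ((4 / δ + 1) * (1 - δ)) := by
        rw [Real.mul_rpow hD (by positivity), ← Real.rpow_mul hr0.le]; ring
    _ ≤ 316 * c * D ^ (1 - δ) * (r : ℝ) ^ (4 / δ) := by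
        gcongr
        have : (4 / δ + 1) * (1 - δ) = 4 / δ - 3 - δ := by field_simp; ring
        linarith

end

theorem lemma7 :
    ∃ N : ℕ, ∀ n₀ : ℕ, (IsCubicExpanderThreshold n₀ ∨ N ≤ n₀) →
      ∀ c δ : ℝ, 1 ≤ c → 0 < δ → δ ≤ 1 →
        (∀ r : ℕ, 1 ≤ r →
          ∀ {V : Type*} [Finite V] (G : SimpleGraph V), G.HasBalancedSeparators c (1 - δ) →
            ∀ {W : Type*} (H : SimpleGraph W), H.IsShallowMinor r G →
              H.HasBalancedSeparators (sepP n₀ c δ r) (1 - 5 / 6 * δ)) ∧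
        Asymptotics.IsBigO Filter.atTop (fun r : ℕ => sepP n₀ c δ r)
          (fun r : ℕ => (r : ℝ) ^ (4 / δ)) :=
  ⟨0, fun n₀ _ _ _ hc hδ hδ1 => ⟨fun _ hr _ _ _ hG _ _ hH =>
    hH.hasBalancedSeparators hr n₀ hc hδ hδ1 hG, sepP_isBigO n₀ (zero_le_one.trans hc) hδ hδ1⟩⟩
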